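/- **Setting.** Let $(V,\langle\cdot,\cdot\rangle)$ be a finite-dimensional Euclidean vector space, with Clifford algebra given by $v\cdot w+w\cdot v=-2\langle v,w\rangle$, and let $S=S_0\oplus S_1$ be a finite-dimensional $\mathbb Z_2$-graded module over it, with a Euclidean scalar product such that $S_0\perp S_1$ and every Clifford multiplication $\mu(v,\cdot)$, $v\in V$, is skew-symmetric (it exchanges $S_0$ and $S_1$). For $s_0\in S_0$, $s_1\in S_1$, $v\in V$ define $s_0^\flat\cdot s_1\in V$ and $v\cdot s_1^\flat\in S_0'\simeq S_0$ by $\langle s_0^\flat\cdot s_1,v\rangle=\langle v\cdot s_1^\flat,s_0\rangle=\langle\mu(v,s_0),s_1\rangle$, and put $s_0\cdot v=\mu(v,s_0)$. The special $T$-algebra consists of the $3\times3$ matrices $(x_{ij})$ with $x_{ii}\in\mathbb R$, $x_{12}\in S_0$, $x_{13}\in S_1$, $x_{23}\in V$, $x_{21}\in S_0'$, $x_{31}\in S_1'$, $x_{32}\in V'$; the product is matrix multiplication, where the products of entries are those just listed, multiplication by scalars, the pairing $x\cdot y^\flat=x^\flat\cdot y=\langle x,y\rangle$, and the products obtained from these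 by requiring $(AB)^*=B^*A^*$ for the involution $A\mapsto A^*$ that transposes and identifies the spaces with their duals. Let $\mathscr H=\{X=X^*\}$, with coordinates $(x_1,x_2,x_3,v,s_0,s_1)$, let $\mathscr H'=\operatorname{Hom}(\mathscr H,\mathbb R)$, let $X\mapsto X^\flat=\operatorname{tr}(X\cdot\,)$ be the isomorphism $\mathscr H\to\mathscr H'$, and let $y_1$ be the first coordinate on $\mathscr H'$, so that $y_1(X^\flat)=x_1$. The triangular group $G$ acts on $\mathscr H$ as the group generated by the transformations $\exp(T_B)$, $T_BX=BX+XB^*$, with $B$ upper triangular; $G_0\subset G$ is the subgroup generated by those with $\operatorname{tr}B=0$, and $G^*$ is the group obtained in the same way from lower triangular $B$. An element $A\in G$ acts on $\mathscr H'$ by $A'\xi=\xi\circ A^{-1}$. Let $I$ be the identity matrix, $\mathscr V=G(I)$ the special Vinberg cone, $\mathscr V^*=G^*(I)$ its dual cone, and $\mathscr V'=\{\xi\in\mathscr H':\xi(Y)>0\text{ for all }Y\in\overline{\mathscr V}\setminus\{0\}\}$ its adjoint cone. Let $k>0$ and let $$d(X)=k\,d_{\mathscr V}(X),\qquad d_{\mathscr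 V}(X)=x_1x_2x_3-x_1|v|^2-x_2|s_1|^2-x_3|s_0|^2+2\langle\mu(v,s_0),s_1\rangle,$$ $$(d'+\mathfrak d')(X^\flat)=\frac1k\Big(d_{\mathscr V}(X)+\frac{|s_0|^2|s_1|^2-|s_0^\flat\cdot s_1|^2}{x_1}\Big)\qquad(x_1\neq0).$$ The associated quadratic maps $h:\mathscr H\to\mathscr H'$ and $h'+\mathfrak h':\{y_1\ne0\}\subset\mathscr H'\to\mathscr H=\operatorname{Hom}(\mathscr H',\mathbb R)$ are $$h(X)(Y)=\tfrac13\tfrac{d}{ds}\big|_{s=0}d(X+sY),\qquad (h'+\mathfrak h')(\xi)(\eta)=\tfrac13\tfrac{d}{ds}\big|_{s=0}(d'+\mathfrak d')(\xi+s\eta).$$ Put $\mathscr H_+,\mathscr H_-,\mathscr H_0=\{d>0\},\{d<0\},\{d=0\}$, each intersected with $\{y_1\circ h\ne0\}$, and $\mathscr H'_+,\mathscr H'_-,\mathscr H'_0=\{d'+\mathfrak d'>0\},\{d'+\mathfrak d'<0\},\{d'+\mathfrak d'=0\}$, each intersected with $\{y_1\neq0\}$. **Lemma.** (i) For all $A\in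 G_0$: $h(A(X))=A'(h(X))$ for every $X\in\mathscr H$, and $(h'+\mathfrak h')(A'\xi)=A\big((h'+\mathfrak h')(\xi)\big)$ for every $\xi\in\mathscr H'$ with $y_1(\xi)\neq0$ (then $y_1(A'\xi)\ne0$). Moreover $h$ maps every $G$-orbit in $\mathscr H$ into a $G$-orbit in $\mathscr H'$, and $h'+\mathfrak h'$ maps every $G$-orbit through a point with $y_1\neq0$ into a $G$-orbit in $\mathscr H$. (ii) $h(I)=\frac k3I^\flat$ and $(h'+\mathfrak h')(I^\flat)=\frac1{3k}I$. (iii) $(h'+\mathfrak h')(h(X))=\frac1{27}d(X)\,X$ for every $X\in\mathscr H$ with $y_1(h(X))\neq0$, and $h\big((h'+\mathfrak h')(\xi)\big)=\frac1{27}(d'+\mathfrak d')(\xi)\,\xi$ for every $\xi\in\mathscr H'$ with $y_1(\xi)\ne0$. In terms of the unnormalised gradient maps $H=3h$ and $H'=3(h'+\mathfrak h')$, the identities (ii) and (iii) read $H(I)=kI^\flat$, $H'(I^\flat)=\frac1kI$, $H'(H(X))=d(X)X$ and $H(H'(\xi))=(d'+\mathfrak d')(\xi)\xi$. (iv) For every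 $X\in\mathscr H_+\cup\mathscr H_-$ the orbit $G(X)$ lies in $\mathscr H_+\cup\mathscr H_-$, and $h$ maps it diffeomorphically onto the $G$-orbit of $h(X)$, which lies in $\mathscr H'_+$. For every $\xi\in\mathscr H'_+\cup\mathscr H'_-$ the $G$-orbit of $\xi$ lies in $\mathscr H'_+\cup\mathscr H'_-$, and $h'+\mathfrak h'$ maps it diffeomorphically onto the $G$-orbit of $(h'+\mathfrak h')(\xi)$, which lies in $\mathscr H_+$. Furthermore $h(\mathscr H_0)\subset\mathscr H'_0$ and $(h'+\mathfrak h')(\mathscr H'_0)\subset\{d=0\}$. In particular $\mathscr V\subset\mathscr H_+$, $\mathscr V'\subset\mathscr H'_+$, $\mathscr V'=(\mathscr V^*)^\flat$, and $h:\mathscr V\to\mathscr V'$ and $h'+\mathfrak h':\mathscr V'\to\mathscr V$ are diffeomorphisms. (v) Each of $h:\mathscr H_+\to\mathscr H'_+$, $h:\mathscr H_-\to\mathscr H'_+$, $h'+\mathfrak h':\mathscr H'_+\to\mathscr H_+$ and $h'+\mathfrak h':\mathscr H'_-\to\mathscr H_+$ is a diffeomorphism onto. -/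

import Mathlib

open scoped ContDiff

noncomputable section

namespace SpecialVinberg

/-- The quadratic form `v ↦ -⟨v, v⟩`; its Clifford algebra has the relation
`v * w + w * v = -2 ⟨v, w⟩`. -/
def cliffordForm (V : Type*) [NormedAddCommGroup V] [InnerProductSpace ℝ V] :
    QuadraticForm ℝ V :=
  -(LinearMap.BilinMap.toQuadraticMap (innerₗ V))

/-- A metric `ℤ₂`-graded Clifford module `S = S₀ + S₁` over the Clifford algebra of the Euclidean
space `V`: the summands are orthogonal, Clifford multiplication by a vector is odd and
skew-symmetric. -/
structure MetricCliffordModule (V S : Type*)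
    [NormedAddCommGroup V] [InnerProductSpace ℝ V]
    [NormedAddCommGroup S] [InnerProductSpace ℝ S] where
  rep : CliffordAlgebra (cliffordForm V) →ₐ[ℝ] Module.End ℝ S
  S₀ : Submodule ℝ S
  S₁ : Submodule ℝ S
  isCompl : IsCompl S₀ S₁
  orthogonal : ∀ s ∈ S₀, ∀ t ∈ S₁, inner ℝ s t = 0
  odd₀ : ∀ (v : V), ∀ s ∈ S₀, rep (CliffordAlgebra.ι (cliffordForm V) v) s ∈ S₁
  odd₁ : ∀ (v : V), ∀ s ∈ S₁, rep (CliffordAlgebra.ι (cliffordForm V) v) s ∈ S₀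
  skew : ∀ (v : V) (s t : S),
    inner ℝ (rep (CliffordAlgebra.ι (cliffordForm V) v) s) t =
      -inner ℝ s (rep (CliffordAlgebra.ι (cliffordForm V) v) t)

/-- `f` restricts to a diffeomorphism of `s` onto `t` (arbitrary subsets of normed spaces): it is
a bijection of `s` onto `t`, smooth on an open neighbourhood of `s`, and its inverse extends to a
smooth map on an open neighbourhood of `t`. -/
def IsDiffeoOnto {E F : Type*} [NormedAddCommGroup E] [NormedSpace ℝ E]
    [NormedAddCommGroup F] [NormedSpace ℝ F] (f : E → F) (s : Set E) (t : Set F) : Prop :=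
  Set.BijOn f s t ∧
  (∃ U : Set E, IsOpen U ∧ s ⊆ U ∧ ContDiffOn ℝ ∞ f U) ∧
  ∃ (g : F → E) (W : Set F), IsOpen W ∧ t ⊆ W ∧ ContDiffOn ℝ ∞ g W ∧ ∀ x ∈ s, g (f x) = x

/-- The exponential of a continuous linear map. -/
def expMap {E : Type*} [NormedAddCommGroup E] [NormedSpace ℝ E] (L : E →L[ℝ] E) : E →L[ℝ] E :=
  NormedSpace.exp L

namespace MetricCliffordModule

section

set_option linter.unusedSectionVars false

variable {V S : Type*} [NormedAddCommGroup V] [InnerProductSpace ℝ V] [FiniteDimensional ℝ V]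
  [NormedAddCommGroup S] [InnerProductSpace ℝ S] [FiniteDimensional ℝ S]
  (M : MetricCliffordModule V S)

/-- Clifford multiplication `μ : V × S₀ → S₁`. -/
def mu : V →ₗ[ℝ] M.S₀ →ₗ[ℝ] M.S₁ :=
  LinearMap.mk₂ ℝ
    (fun v s => ⟨M.rep (CliffordAlgebra.ι (cliffordForm V) v) s, M.odd₀ v s s.2⟩)
    (fun v w s => by ext; simp) (fun c v s => by ext; simp)
    (fun v s t => by ext; simp) (fun c v s => by ext; simp)

/-- The transpose `V × S₁ → S₀` of `μ`: `⟨muT v s₁, s₀⟩ = ⟨μ(v, s₀), s₁⟩`. -/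
def muT (v : V) (s₁ : M.S₁) : M.S₀ := LinearMap.adjoint (M.mu v) s₁

/-- The vector `s₀♭ · s₁ ∈ V`: `⟨gam s₀ s₁, v⟩ = ⟨μ(v, s₀), s₁⟩`. -/
def gam (s₀ : M.S₀) (s₁ : M.S₁) : V := LinearMap.adjoint (M.mu.flip s₀) s₁

theorem inner_muT (v : V) (s₀ : M.S₀) (s₁ : M.S₁) :
    inner ℝ (M.muT v s₁) s₀ = inner ℝ (M.mu v s₀) s₁ := by
  rw [muT, LinearMap.adjoint_inner_left, real_inner_comm]

theorem inner_gam (v : V) (s₀ : M.S₀) (s₁ : M.S₁) :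
    inner ℝ (M.gam s₀ s₁) v = inner ℝ (M.mu v s₀) s₁ := by
  rw [gam, LinearMap.adjoint_inner_left, real_inner_comm]; rfl

/-- An element of the special `T`-algebra, as a `3 × 3` matrix. The entries below the diagonal
lie in the dual spaces `S₀'`, `S₁'`, `V'`; they are recorded by the vectors that represent them
through the scalar product, so that `x21 = t` stands for the entry `t♭ ∈ S₀'`. -/
@[ext]
structure Mat where
  x11 : ℝ
  x22 : ℝ
  x33 : ℝ
  x12 : M.S₀
  x13 : M.S₁
  x23 : V
  x21 : M.S₀
  x31 : M.S₁
  x32 : V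

variable {M} in
/-- The product of the `T`-algebra (matrix multiplication with the products of entries). -/
def Mat.mul (A B : M.Mat) : M.Mat where
  x11 := A.x11 * B.x11 + inner ℝ A.x12 B.x21 + inner ℝ A.x13 B.x31
  x22 := inner ℝ A.x21 B.x12 + A.x22 * B.x22 + inner ℝ A.x23 B.x32
  x33 := inner ℝ A.x31 B.x13 + inner ℝ A.x32 B.x23 + A.x33 * B.x33
  x12 := A.x11 • B.x12 + B.x22 • A.x12 + M.muT B.x32 A.x13
  x13 := A.x11 • B.x13 + M.mu B.x23 A.x12 + B.x33 • A.x13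
  x23 := M.gam A.x21 B.x13 + A.x22 • B.x23 + B.x33 • A.x23
  x21 := B.x11 • A.x21 + A.x22 • B.x21 + M.muT A.x23 B.x31
  x31 := B.x11 • A.x31 + M.mu A.x32 B.x21 + A.x33 • B.x31
  x32 := M.gam B.x12 A.x31 + B.x22 • A.x32 + A.x33 • B.x32

variable {M} in
def Mat.add (A B : M.Mat) : M.Mat where
  x11 := A.x11 + B.x11
  x22 := A.x22 + B.x22
  x33 := A.x33 + B.x33
  x12 := A.x12 + B.x12
  x13 := A.x13 + B.x13
  x23 := A.x23 + B.x23
  x21 := A.x21 + B.x21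
  x31 := A.x31 + B.x31
  x32 := A.x32 + B.x32

variable {M} in
/-- The involution `A ↦ A*`. -/
def Mat.conj (A : M.Mat) : M.Mat where
  x11 := A.x11
  x22 := A.x22
  x33 := A.x33
  x12 := A.x21
  x13 := A.x31
  x23 := A.x32
  x21 := A.x12
  x31 := A.x13
  x32 := A.x23

variable {M} in
def Mat.tr (A : M.Mat) : ℝ := A.x11 + A.x22 + A.x33

variable {M} in
/-- Upper triangular matrices: the Lie algebra of the triangular group `G`. -/
def Mat.IsUpper (A : M.Mat) : Prop := A.x21 = 0 ∧ A.x31 = 0 ∧ A.x32 = 0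

variable {M} in
/-- Lower triangular matrices: the Lie algebra of the dual triangular group `G*`. -/
def Mat.IsLower (A : M.Mat) : Prop := A.x12 = 0 ∧ A.x13 = 0 ∧ A.x23 = 0

/-- The space of Hermitian matrices, in the coordinates `(x₁, x₂, x₃, v, s₀, s₁)`. -/
abbrev Herm : Type _ := ℝ × ℝ × ℝ × V × M.S₀ × M.S₁

/-- The dual space `Hom(Herm, ℝ)`. -/
abbrev HermDual : Type _ := M.Herm →L[ℝ] ℝ

/-- The Hermitian matrix with given coordinates. -/
def toMat (X : M.Herm) : M.Mat where
  x11 := X.1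
  x22 := X.2.1
  x33 := X.2.2.1
  x23 := X.2.2.2.1
  x12 := X.2.2.2.2.1
  x13 := X.2.2.2.2.2
  x32 := X.2.2.2.1
  x21 := X.2.2.2.2.1
  x31 := X.2.2.2.2.2

variable {M} in
/-- The coordinates of a matrix, read off its upper triangular part. -/
def Mat.upperPart (A : M.Mat) : M.Herm := (A.x11, A.x22, A.x33, A.x23, A.x12, A.x13)

/-- The identity matrix. -/
def one : M.Herm := (1, 1, 1, 0, 0, 0)

theorem muT_add_left (v w : V) (s : M.S₁) : M.muT (v + w) s = M.muT v s + M.muT w s := by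
  simp [muT]

theorem muT_smul_left (c : ℝ) (v : V) (s : M.S₁) : M.muT (c • v) s = c • M.muT v s := by
  simp [muT]

theorem muT_add_right (v : V) (s t : M.S₁) : M.muT v (s + t) = M.muT v s + M.muT v t := by
  simp [muT]

theorem muT_smul_right (c : ℝ) (v : V) (s : M.S₁) : M.muT v (c • s) = c • M.muT v s := by
  simp [muT]

theorem gam_add_left (s s' : M.S₀) (t : M.S₁) : M.gam (s + s') t = M.gam s t + M.gam s' t := by
  simp [gam]

theorem gam_smul_left (c : ℝ) (s : M.S₀) (t : M.S₁) : M.gam (c • s) t = c • M.gam s t := by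
  simp [gam]

theorem gam_add_right (s : M.S₀) (t t' : M.S₁) : M.gam s (t + t') = M.gam s t + M.gam s t' := by
  simp [gam]

theorem gam_smul_right (c : ℝ) (s : M.S₀) (t : M.S₁) : M.gam s (c • t) = c • M.gam s t := by
  simp [gam]

/-- The linear map `T_B X = B · X + X · B*` on Hermitian matrices. -/
def T (B : M.Mat) : M.Herm →L[ℝ] M.Herm :=
  LinearMap.toContinuousLinearMap
    { toFun := fun X => ((B.mul (M.toMat X)).add ((M.toMat X).mul B.conj)).upperPart
      map_add' := fun X Y => by
        simp only [Mat.upperPart, Mat.add, Mat.mul, Mat.conj, toMat, Prod.fst_add, Prod.snd_add,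
          muT_add_left, muT_add_right, gam_add_left, gam_add_right, map_add, LinearMap.add_apply,
          inner_add_left, inner_add_right, smul_add, add_smul, Prod.mk_add_mk, Prod.mk.injEq]
        refine ⟨by ring, by ring, by ring, by abel, by abel, by abel⟩
      map_smul' := fun c X => by
        simp only [Mat.upperPart, Mat.add, Mat.mul, Mat.conj, toMat, Prod.smul_fst, Prod.smul_snd,
          muT_smul_left, muT_smul_right, gam_smul_left, gam_smul_right, map_smul,
          LinearMap.smul_apply, inner_smul_left, inner_smul_right, smul_eq_mul, RingHom.id_apply,
          Prod.smul_mk, Prod.mk.injEq, conj_trivial]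
        refine ⟨by ring, by ring, by ring, by module, by module, by module⟩ }

/-- `B · X + X · B*` is indeed Hermitian, with the coordinates `T B X`. -/
theorem toMat_T (B : M.Mat) (X : M.Herm) :
    M.toMat (M.T B X) = (B.mul (M.toMat X)).add ((M.toMat X).mul B.conj) := by
  simp only [T, LinearMap.coe_toContinuousLinearMap', LinearMap.coe_mk, AddHom.coe_mk]
  ext1 <;> simp only [toMat, Mat.upperPart, Mat.add, Mat.mul, Mat.conj] <;> abel

/-- The group of linear transformations generated by the `exp (T_B)`, where `B` runs through the
matrices with property `P`. -/
def expGroup (P : M.Mat → Prop) : Subgroup (M.Herm ≃L[ℝ] M.Herm) :=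
  Subgroup.closure {A | ∃ B : M.Mat, P B ∧ (A : M.Herm →L[ℝ] M.Herm) = expMap (M.T B)}

/-- The triangular group `G`, acting on Hermitian matrices. -/
def G : Subgroup (M.Herm ≃L[ℝ] M.Herm) := M.expGroup Mat.IsUpper

/-- The unimodular subgroup `G₀` of `G`. -/
def G₀ : Subgroup (M.Herm ≃L[ℝ] M.Herm) := M.expGroup fun B => B.IsUpper ∧ B.tr = 0

/-- The dual triangular group `G*`, acting on Hermitian matrices. -/
def Gstar : Subgroup (M.Herm ≃L[ℝ] M.Herm) := M.expGroup Mat.IsLower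

variable {M} in
/-- The dual transformation `A'` on the dual space: `(A' ξ)(Y) = ξ (A⁻¹ Y)`. -/
def dualAct (A : M.Herm ≃L[ℝ] M.Herm) (ξ : M.HermDual) : M.HermDual :=
  ξ.comp (A.symm : M.Herm →L[ℝ] M.Herm)

/-- The `G`-orbit of a Hermitian matrix. -/
def orbit (X : M.Herm) : Set M.Herm := {Y | ∃ A ∈ M.G, Y = A X}

/-- The `G`-orbit of an element of the dual space. -/
def dualOrbit (ξ : M.HermDual) : Set M.HermDual := {η | ∃ A ∈ M.G, η = dualAct A ξ}

/-- The special Vinberg cone `G(I)`. -/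
def cone : Set M.Herm := M.orbit M.one

/-- The dual cone `G*(I)`. -/
def dualCone : Set M.Herm := {Y | ∃ A ∈ M.Gstar, Y = A M.one}

/-- The adjoint cone, in the dual space. -/
def adjointCone : Set M.HermDual := {ξ | ∀ Y ∈ closure M.cone, Y ≠ 0 → 0 < ξ Y}

/-- The map `X ↦ X♭ = tr (X · _)`, as a linear map. -/
def flatLin : M.Herm →ₗ[ℝ] M.HermDual where
  toFun X := LinearMap.toContinuousLinearMap
    { toFun := fun Y => ((M.toMat X).mul (M.toMat Y)).tr
      map_add' := fun Y Z => by
        simp only [Mat.tr, Mat.mul, toMat, Prod.fst_add, Prod.snd_add, inner_add_right]; ring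
      map_smul' := fun c Y => by
        simp only [Mat.tr, Mat.mul, toMat, Prod.smul_fst, Prod.smul_snd, inner_smul_right,
          smul_eq_mul, RingHom.id_apply]; ring }
  map_add' X Y := by
    refine ContinuousLinearMap.ext fun Z => ?_
    simp only [LinearMap.coe_toContinuousLinearMap', LinearMap.coe_mk, AddHom.coe_mk, Mat.tr,
      Mat.mul, toMat, Prod.fst_add, Prod.snd_add, inner_add_left, add_apply]
    ring
  map_smul' c X := by
    refine ContinuousLinearMap.ext fun Z => ?_
    simp only [LinearMap.coe_toContinuousLinearMap', LinearMap.coe_mk, AddHom.coe_mk, Mat.tr,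
      Mat.mul, toMat, Prod.smul_fst, Prod.smul_snd, inner_smul_left, smul_eq_mul,
      RingHom.id_apply, smul_apply, conj_trivial]
    ring

theorem flatLin_apply (X Y : M.Herm) :
    M.flatLin X Y = ((M.toMat X).mul (M.toMat Y)).tr := rfl

theorem flatLin_injective : Function.Injective M.flatLin := by
  rw [← LinearMap.ker_eq_bot, LinearMap.ker_eq_bot']
  intro X hX
  have h : M.flatLin X X = 0 := by rw [hX]; rfl
  obtain ⟨a, b, c, v, s, t⟩ := X
  simp only [flatLin_apply, Mat.tr, Mat.mul, toMat, real_inner_self_eq_norm_sq] at h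
  have := sq_nonneg a
  have := sq_nonneg b
  have := sq_nonneg c
  have := sq_nonneg ‖v‖
  have := sq_nonneg ‖s‖
  have := sq_nonneg ‖t‖
  have ha : a = 0 := pow_eq_zero_iff two_ne_zero |>.mp (by nlinarith)
  have hb : b = 0 := pow_eq_zero_iff two_ne_zero |>.mp (by nlinarith)
  have hc : c = 0 := pow_eq_zero_iff two_ne_zero |>.mp (by nlinarith)
  have hv : ‖v‖ = 0 := pow_eq_zero_iff two_ne_zero |>.mp (by nlinarith)
  have hs : ‖s‖ = 0 := pow_eq_zero_iff two_ne_zero |>.mp (by nlinarith)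
  have ht : ‖t‖ = 0 := pow_eq_zero_iff two_ne_zero |>.mp (by nlinarith)
  rw [norm_eq_zero] at hv hs ht
  subst ha hb hc hv hs ht
  rfl

/-- The isomorphism `♭` of the space of Hermitian matrices onto its dual. -/
def flat : M.Herm ≃ₗ[ℝ] M.HermDual :=
  LinearMap.linearEquivOfInjective M.flatLin M.flatLin_injective
    ((Subspace.dual_finrank_eq (K := ℝ) (V := M.Herm)).symm.trans
      (LinearMap.toContinuousLinearMap (𝕜 := ℝ) (E := M.Herm) (F' := ℝ)).finrank_eq)

theorem flat_apply (X Y : M.Herm) : M.flat X Y = ((M.toMat X).mul (M.toMat Y)).tr := rfl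

/-- The normalised invariant cubic polynomial. -/
def dV (X : M.Herm) : ℝ :=
  let (x₁, x₂, x₃, v, s₀, s₁) := X
  x₁ * x₂ * x₃ - x₁ * ‖v‖ ^ 2 - x₂ * ‖s₁‖ ^ 2 - x₃ * ‖s₀‖ ^ 2 + 2 * inner ℝ (M.mu v s₀) s₁

/-- The rational correction term; only meaningful where `x₁ ≠ 0`. -/
def frakd (X : M.Herm) : ℝ :=
  let (x₁, _, _, _, s₀, s₁) := X
  (‖s₀‖ ^ 2 * ‖s₁‖ ^ 2 - ‖M.gam s₀ s₁‖ ^ 2) / x₁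

/-- The invariant cubic polynomial with value `k` at the identity matrix. -/
def d (k : ℝ) (X : M.Herm) : ℝ := k * M.dV X

/-- The canonically associated dual rational function on the dual space. -/
def d' (k : ℝ) (ξ : M.HermDual) : ℝ := (1 / k) * (M.dV (M.flat.symm ξ) + M.frakd (M.flat.symm ξ))

/-- The first coordinate on the dual space. -/
def y₁ (ξ : M.HermDual) : ℝ := ξ (1, 0, 0, 0, 0, 0)

/-- The quadratic map of `d`: `h(X)(Y) = (1/3) (d/ds) d(X + s Y)` at `s = 0`. -/
def h (k : ℝ) (X : M.Herm) : M.HermDual := (1 / 3 : ℝ) • fderiv ℝ (M.d k) X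

/-- The quadratic map of the dual rational function, with values in the space of Hermitian
matrices identified with its double dual; see `apply_h'`. -/
def h' (k : ℝ) (ξ : M.HermDual) : M.Herm :=
  (Module.evalEquiv ℝ M.Herm).symm
    (((1 / 3 : ℝ) • fderiv ℝ (M.d' k) ξ).toLinearMap ∘ₗ
      (LinearMap.toContinuousLinearMap (𝕜 := ℝ) (E := M.Herm) (F' := ℝ)).toLinearMap)

theorem apply_h' (k : ℝ) (ξ η : M.HermDual) :
    η (M.h' k ξ) = (1 / 3) * fderiv ℝ (M.d' k) ξ η := by
  have := Module.apply_evalEquiv_symm_apply (R := ℝ) (M := M.Herm) (η : M.Herm →ₗ[ℝ] ℝ)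
    (((1 / 3 : ℝ) • fderiv ℝ (M.d' k) ξ).toLinearMap ∘ₗ
      (LinearMap.toContinuousLinearMap (𝕜 := ℝ) (E := M.Herm) (F' := ℝ)).toLinearMap)
  exact this

/-- `{d > 0, y₁ ∘ h ≠ 0}` -/
def Hplus (k : ℝ) : Set M.Herm := {X | 0 < M.d k X ∧ M.y₁ (M.h k X) ≠ 0}

/-- `{d < 0, y₁ ∘ h ≠ 0}` -/
def Hminus (k : ℝ) : Set M.Herm := {X | M.d k X < 0 ∧ M.y₁ (M.h k X) ≠ 0}

/-- `{d = 0, y₁ ∘ h ≠ 0}` -/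
def Hzero (k : ℝ) : Set M.Herm := {X | M.d k X = 0 ∧ M.y₁ (M.h k X) ≠ 0}

/-- The subset of the dual space where the dual rational function is positive and `y₁ ≠ 0`. -/
def Hplus' (k : ℝ) : Set M.HermDual := {ξ | 0 < M.d' k ξ ∧ M.y₁ ξ ≠ 0}

/-- The subset of the dual space where the dual rational function is negative and `y₁ ≠ 0`. -/
def Hminus' (k : ℝ) : Set M.HermDual := {ξ | M.d' k ξ < 0 ∧ M.y₁ ξ ≠ 0}

/-- The subset of the dual space where the dual rational function vanishes and `y₁ ≠ 0`. -/
def Hzero' (k : ℝ) : Set M.HermDual := {ξ | M.d' k ξ = 0 ∧ M.y₁ ξ ≠ 0}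

end

end MetricCliffordModule

end SpecialVinberg

end

noncomputable section

namespace SpecialVinberg

namespace MetricCliffordModule

variable {V S : Type*} [NormedAddCommGroup V] [InnerProductSpace ℝ V] [FiniteDimensional ℝ V]
  [NormedAddCommGroup S] [InnerProductSpace ℝ S] [FiniteDimensional ℝ S]
  (M : MetricCliffordModule V S)

set_option linter.unusedSectionVars false
set_option maxSynthPendingDepth 3

/-! ### Clifford identities -/

/-! The gradient of `dV` is `♭` of the quadratic map `adj`, and the gradient of `dualNorm = dV +
frakd` is `♭` of the rational map `dualAdj`. Up to scalars these are `h` and `h'`. The core is a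
pair of algebraic identities, `dualAdj (adj X) = dV X • X` and `adj (dualAdj Y) = dualNorm Y • Y`,
which follow from the Clifford relation through the products `gam_mu`, `gam_muT` and `gam_muT_mu`.
With Euler's identity they give `d' (h X) = d X ^ 2 / 27`. Hence, on each sign of `d`, the scalar in
`h' (h X) = (d X / 27) • X` can be recovered from `h X` by a square root, and dividing by it inverts
`h` smoothly. The same argument inverts `h'`.

For the group, the derivative of `dV` along `T B` with `B` upper triangular is `2 tr B` times `dV`,
and `dualNorm` behaves likewise for lower triangular matrices (`flat_adj_T`, `flat_dualAdj_T`).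
Under `♭` the transpose of `T B` is `T B.conj`, so integrating both statements shows that `G` scales
`d` by a positive character and `d'` by its inverse. Differentiating gives equivariance of `h` and
`h'` up to positive scalars. These scalars belong to `G`, so orbits go onto orbits.

For the cones, positivity of minors puts `♭ I` in the adjoint cone, which is `G`-invariant.
Conversely, Gaussian elimination by lower triangular exponentials brings any element of the adjoint
cone to positive diagonal form, so it lies in `♭ (G* I)`. -/

theorem rep_rep_self (v : V) (s : S) :
    M.rep (CliffordAlgebra.ι (cliffordForm V) v) (M.rep (CliffordAlgebra.ι (cliffordForm V) v) s) =
      -(‖v‖ ^ 2 • s) := by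
  rw [← Module.End.mul_apply, ← map_mul, CliffordAlgebra.ι_sq_scalar, AlgHom.commutes]
  rw [Module.algebraMap_end_apply]
  simp [cliffordForm]

theorem coe_mu (v : V) (s : M.S₀) :
    (M.mu v s : S) = M.rep (CliffordAlgebra.ι (cliffordForm V) v) s := rfl

/-- Skew-symmetry makes the transpose of `mu v` minus Clifford multiplication, so the sign in the
Clifford relation cancels in both composites of `mu v` and `muT v`. -/
theorem coe_muT (v : V) (t : M.S₁) :
    (M.muT v t : S) = -M.rep (CliffordAlgebra.ι (cliffordForm V) v) t := by
  have : M.muT v t = -⟨M.rep (CliffordAlgebra.ι (cliffordForm V) v) t, M.odd₁ v t t.2⟩ := by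
    refine ext_inner_right ℝ fun s => ?_
    rw [inner_muT, Submodule.coe_inner, Submodule.coe_inner, coe_mu, M.skew, real_inner_comm]
    simp
  rw [this]; rfl

theorem muT_mu_self (v : V) (s : M.S₀) : M.muT v (M.mu v s) = ‖v‖ ^ 2 • s := by
  ext; rw [coe_muT, coe_mu, rep_rep_self]; simp

theorem mu_muT_self (v : V) (t : M.S₁) : M.mu v (M.muT v t) = ‖v‖ ^ 2 • t := by
  ext; rw [coe_mu, coe_muT, map_neg, rep_rep_self]; simp

theorem inner_mu (v : V) (s : M.S₀) (t : M.S₁) :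
    inner ℝ (M.mu v s) t = inner ℝ (M.gam s t) v := (M.inner_gam v s t).symm

theorem inner_mu_right (v : V) (s : M.S₀) (t : M.S₁) :
    inner ℝ t (M.mu v s) = inner ℝ (M.gam s t) v := by rw [real_inner_comm, inner_mu]

theorem inner_muT_left (v : V) (s : M.S₀) (t : M.S₁) :
    inner ℝ (M.muT v t) s = inner ℝ (M.gam s t) v := by rw [inner_muT, inner_mu]

theorem inner_muT_right (v : V) (s : M.S₀) (t : M.S₁) :
    inner ℝ s (M.muT v t) = inner ℝ (M.gam s t) v := by rw [real_inner_comm, inner_muT_left]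

theorem mu_muT_add (v w : V) (t : M.S₁) :
    M.mu v (M.muT w t) + M.mu w (M.muT v t) = (2 * inner ℝ v w : ℝ) • t := by
  have h := M.mu_muT_self (v + w) t
  rw [norm_add_sq_real] at h
  simp only [muT_add_left, map_add, LinearMap.add_apply, mu_muT_self, add_smul] at h
  rw [← sub_eq_zero] at h ⊢
  rw [← h]; abel

/-- Polarisation in the vector of `‖μ(w, s)‖² = ‖w‖² ‖s‖²`. -/
theorem gam_mu (s : M.S₀) (v : V) : M.gam s (M.mu v s) = ‖s‖ ^ 2 • v := by
  refine ext_inner_right ℝ fun w => ?_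
  have key (w : V) : inner ℝ (M.mu w s) (M.mu w s) = ‖w‖ ^ 2 * ‖s‖ ^ 2 := by
    rw [← inner_muT, muT_mu_self, inner_smul_left, real_inner_self_eq_norm_sq]; simp
  have h := key (w + v)
  rw [map_add, LinearMap.add_apply, inner_add_left, inner_add_right, inner_add_right, key, key,
    norm_add_sq_real, real_inner_comm (M.mu w s) (M.mu v s)] at h
  rw [inner_gam, inner_smul_left, real_inner_comm w v]
  simp only [conj_trivial]
  linarith

/-- After pairing with `t`, the two terms of the polarised relation `mu_muT_add` are equal by
symmetry of the scalar product. -/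
theorem gam_muT (t : M.S₁) (v : V) : M.gam (M.muT v t) t = ‖t‖ ^ 2 • v := by
  refine ext_inner_right ℝ fun w => ?_
  have h := congrArg (fun x => inner ℝ x t) (M.mu_muT_add w v t)
  simp only [inner_add_left, inner_smul_left, real_inner_self_eq_norm_sq, conj_trivial] at h
  have h2 : inner ℝ (M.mu v (M.muT w t)) t = inner ℝ (M.mu w (M.muT v t)) t := by
    rw [← inner_muT, ← inner_muT, real_inner_comm]
  rw [inner_gam, inner_smul_left, real_inner_comm w v]
  simp only [conj_trivial]
  linarith

/-- Pairing the polarised relation with `μ(v, s)` leaves one term that is the wanted pairing and one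
that collapses because `muT v` inverts `mu v` up to `‖v‖²`. -/
theorem gam_muT_mu (v : V) (s : M.S₀) (t : M.S₁) :
    M.gam (M.muT v t) (M.mu v s) = (2 * inner ℝ (M.gam s t) v : ℝ) • v - ‖v‖ ^ 2 • M.gam s t := by
  refine ext_inner_right ℝ fun w => ?_
  have h := congrArg (fun x => inner ℝ x (M.mu v s)) (M.mu_muT_add w v t)
  simp only [inner_add_left, inner_smul_left, conj_trivial, inner_mu_right] at h
  have h2 : inner ℝ (M.gam s (M.mu v (M.muT w t))) v = ‖v‖ ^ 2 * inner ℝ (M.gam s t) w := by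
    rw [inner_gam, ← inner_muT, muT_mu_self, inner_smul_left, inner_muT_left]; simp
  have h3 : inner ℝ (M.gam s (M.mu w (M.muT v t))) v =
      inner ℝ (M.gam (M.muT v t) (M.mu v s)) w := by
    rw [inner_gam, inner_gam, real_inner_comm]
  rw [inner_sub_left, inner_smul_left, inner_smul_left, real_inner_comm w v]
  simp only [conj_trivial]
  linarith

/-! ### The two adjoint maps -/

/-- The adjoint of a Hermitian matrix: `♭` of it is the differential of `dV`. -/
def adj (X : M.Herm) : M.Herm :=
  let (x₁, x₂, x₃, v, s₀, s₁) := X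
  (x₂ * x₃ - ‖v‖ ^ 2, x₁ * x₃ - ‖s₁‖ ^ 2, x₁ * x₂ - ‖s₀‖ ^ 2, M.gam s₀ s₁ - x₁ • v,
    M.muT v s₁ - x₃ • s₀, M.mu v s₀ - x₂ • s₁)

/-- The dual rational function `dV + frakd`, in the coordinates of `Herm`. -/
def dualNorm (Y : M.Herm) : ℝ := M.dV Y + M.frakd Y

/-- The rational adjoint: `♭` of it is the differential of `dualNorm`. -/
def dualAdj (Y : M.Herm) : M.Herm :=
  let (y₁, y₂, y₃, w, t₀, t₁) := Y
  (y₂ * y₃ - ‖w‖ ^ 2 - (‖t₀‖ ^ 2 * ‖t₁‖ ^ 2 - ‖M.gam t₀ t₁‖ ^ 2) / y₁ ^ 2,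
    y₁ * y₃ - ‖t₁‖ ^ 2, y₁ * y₂ - ‖t₀‖ ^ 2, M.gam t₀ t₁ - y₁ • w,
    -y₁⁻¹ • (M.muT (M.gam t₀ t₁ - y₁ • w) t₁ + (y₁ * y₃ - ‖t₁‖ ^ 2) • t₀),
    -y₁⁻¹ • (M.mu (M.gam t₀ t₁ - y₁ • w) t₀ + (y₁ * y₂ - ‖t₀‖ ^ 2) • t₁))

theorem norm_muT_sq (v : V) (t : M.S₁) : ‖M.muT v t‖ ^ 2 = ‖v‖ ^ 2 * ‖t‖ ^ 2 := by
  rw [← real_inner_self_eq_norm_sq, inner_muT, mu_muT_self, inner_smul_left,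
    real_inner_self_eq_norm_sq]; simp

theorem norm_mu_sq (v : V) (s : M.S₀) : ‖M.mu v s‖ ^ 2 = ‖v‖ ^ 2 * ‖s‖ ^ 2 := by
  rw [← real_inner_self_eq_norm_sq, ← inner_muT, muT_mu_self, inner_smul_left,
    real_inner_self_eq_norm_sq]; simp

theorem norm_sq_muT_add (v : V) (s : M.S₀) (t : M.S₁) (c : ℝ) :
    ‖M.muT v t + c • s‖ ^ 2 =
      ‖v‖ ^ 2 * ‖t‖ ^ 2 + 2 * c * inner ℝ (M.gam s t) v + c ^ 2 * ‖s‖ ^ 2 := by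
  rw [norm_add_sq_real, norm_muT_sq, inner_smul_right, inner_muT_left, norm_smul, mul_pow,
    Real.norm_eq_abs, sq_abs]; ring

theorem norm_sq_mu_add (v : V) (s : M.S₀) (t : M.S₁) (c : ℝ) :
    ‖M.mu v s + c • t‖ ^ 2 =
      ‖v‖ ^ 2 * ‖s‖ ^ 2 + 2 * c * inner ℝ (M.gam s t) v + c ^ 2 * ‖t‖ ^ 2 := by
  rw [norm_add_sq_real, norm_mu_sq, inner_smul_right, inner_mu, norm_smul, mul_pow,
    Real.norm_eq_abs, sq_abs]; ring

/-- The spinor entries of `adj` and, up to the factor `-y₁⁻¹`, of `dualAdj` have the shape of these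
two arguments. That their product stays in the span of `gam s t` and `v` is what lets both
compositions close up. -/
theorem gam_muT_add_mu_add (v : V) (s : M.S₀) (t : M.S₁) (b c : ℝ) :
    M.gam (M.muT v t + b • s) (M.mu v s + c • t) =
      (b * c - ‖v‖ ^ 2) • M.gam s t +
        (2 * inner ℝ (M.gam s t) v + c * ‖t‖ ^ 2 + b * ‖s‖ ^ 2) • v := by
  simp only [gam_add_left, gam_add_right, gam_smul_left, gam_smul_right, gam_muT_mu, gam_mu,
    gam_muT]
  module

/-- In the vector entry (`hu`) the `gam s t` terms cancel, because their coefficient `x₂ x₃ - ‖v‖²`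
is the first entry of `adj X`. With that entry reduced to `dV X • v`, the spinor entries become
multiples of the same first entry, which cancels the denominator of `dualAdj`. -/
theorem dualAdj_adj (X : M.Herm) (hX : (M.adj X).1 ≠ 0) :
    M.dualAdj (M.adj X) = M.dV X • X := by
  obtain ⟨x₁, x₂, x₃, v, s, t⟩ := X
  simp only [adj] at hX
  have e0 : M.muT v t - x₃ • s = M.muT v t + (-x₃) • s := by module
  have e1 : M.mu v s - x₂ • t = M.mu v s + (-x₂) • t := by module
  have hu : M.gam (M.muT v t + (-x₃) • s) (M.mu v s + (-x₂) • t) -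
      (x₂ * x₃ - ‖v‖ ^ 2) • (M.gam s t - x₁ • v) = M.dV (x₁, x₂, x₃, v, s, t) • v := by
    rw [gam_muT_add_mu_add]
    simp only [dV, inner_mu]
    module
  simp only [dualAdj, adj, e0, e1, hu, Prod.smul_mk, Prod.mk.injEq]
  rw [gam_muT_add_mu_add, norm_sq_muT_add, norm_sq_mu_add]
  refine ⟨?_, ?_, ?_, trivial, ?_, ?_⟩
  · rw [norm_add_sq_real, norm_sub_sq_real]
    simp only [norm_smul, mul_pow, Real.norm_eq_abs, sq_abs, inner_smul_left, inner_smul_right,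
      conj_trivial, dV, inner_mu, smul_eq_mul]
    rw [sub_eq_iff_eq_add', ← sub_eq_iff_eq_add, eq_div_iff (pow_ne_zero 2 hX)]
    ring
  · simp only [dV, inner_mu, smul_eq_mul]; ring
  · simp only [dV, inner_mu, smul_eq_mul]; ring
  · rw [muT_smul_left, muT_add_right, muT_mu_self, muT_smul_right, neg_smul, ← smul_neg,
      inv_smul_eq_iff₀ hX]
    simp only [dV, inner_mu]
    module
  · rw [map_smul, LinearMap.smul_apply, map_add, mu_muT_self, map_smul, neg_smul, ← smul_neg,
      inv_smul_eq_iff₀ hX]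
    simp only [dV, inner_mu]
    module

/-- With `u = gam s t - y₁ • w`, every norm and pairing in the composite is a polynomial in `‖gam s
t‖²`, `⟨gam s t, w⟩`, `‖w‖²`, `‖s‖²`, `‖t‖²` and the diagonal; clearing powers of `y₁` leaves
polynomial identities. -/
theorem adj_dualAdj (Y : M.Herm) (hY : Y.1 ≠ 0) :
    M.adj (M.dualAdj Y) = M.dualNorm Y • Y := by
  obtain ⟨y₁, y₂, y₃, w, s, t⟩ := Y
  simp only at hY
  have hw : w = y₁⁻¹ • (M.gam s t - (M.gam s t - y₁ • w)) := by
    rw [sub_sub_cancel, inv_smul_smul₀ hY]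
  have hu : ‖M.gam s t - y₁ • w‖ ^ 2 =
      ‖M.gam s t‖ ^ 2 - 2 * y₁ * inner ℝ (M.gam s t) w + y₁ ^ 2 * ‖w‖ ^ 2 := by
    rw [norm_sub_sq_real, inner_smul_right, norm_smul, mul_pow, Real.norm_eq_abs, sq_abs]; ring
  have hgu : inner ℝ (M.gam s t) (M.gam s t - y₁ • w) =
      ‖M.gam s t‖ ^ 2 - y₁ * inner ℝ (M.gam s t) w := by
    rw [inner_sub_right, inner_smul_right, real_inner_self_eq_norm_sq]
  simp only [dualAdj, adj, Prod.smul_mk, Prod.mk.injEq, smul_eq_mul]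
  refine ⟨?_, ?_, ?_, ?_, ?_, ?_⟩
  · rw [hu]; simp only [dualNorm, dV, frakd, inner_mu]; field_simp; ring
  · rw [norm_smul, mul_pow, norm_sq_mu_add, hu, hgu, Real.norm_eq_abs, sq_abs]
    simp only [dualNorm, dV, frakd, inner_mu]; field_simp; ring
  · rw [norm_smul, mul_pow, norm_sq_muT_add, hu, hgu, Real.norm_eq_abs, sq_abs]
    simp only [dualNorm, dV, frakd, inner_mu]; field_simp; ring
  · rw [gam_smul_left, gam_smul_right, gam_muT_add_mu_add, hgu, hu]
    simp only [dualNorm, dV, frakd, inner_mu]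
    match_scalars
    · field_simp; ring
    · field_simp; ring
  · rw [muT_smul_right, muT_add_right, muT_mu_self, muT_smul_right, hu]
    simp only [dualNorm, dV, frakd, inner_mu]
    match_scalars
    · field_simp; ring
    · field_simp; ring
  · rw [map_smul, map_add, mu_muT_self, map_smul, hu]
    simp only [dualNorm, dV, frakd, inner_mu]
    match_scalars
    · field_simp; ring
    · field_simp; ring

/-! ### Smoothness and differentials -/

theorem contDiffAt_bilin {D E F G : Type*} [NormedAddCommGroup D] [NormedSpace ℝ D]
    [NormedAddCommGroup E] [NormedSpace ℝ E] [FiniteDimensional ℝ E]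
    [NormedAddCommGroup F] [NormedSpace ℝ F] [FiniteDimensional ℝ F]
    [NormedAddCommGroup G] [NormedSpace ℝ G] (b : E →ₗ[ℝ] F →ₗ[ℝ] G) {f : D → E} {g : D → F}
    {x : D} (hf : ContDiffAt ℝ ∞ f x) (hg : ContDiffAt ℝ ∞ g x) :
    ContDiffAt ℝ ∞ (fun y => b (f y) (g y)) x :=
  (LinearMap.toContinuousBilinearMap b).isBoundedBilinearMap.contDiff.contDiffAt.comp x
    (hf.prodMk hg)

/-- `muT` as a bilinear map. -/
def muTBilin : V →ₗ[ℝ] M.S₁ →ₗ[ℝ] M.S₀ :=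
  LinearMap.mk₂ ℝ M.muT M.muT_add_left M.muT_smul_left M.muT_add_right M.muT_smul_right

/-- `gam` as a bilinear map. -/
def gamBilin : M.S₀ →ₗ[ℝ] M.S₁ →ₗ[ℝ] V :=
  LinearMap.mk₂ ℝ M.gam M.gam_add_left M.gam_smul_left M.gam_add_right M.gam_smul_right

theorem muTBilin_apply (v : V) (t : M.S₁) : M.muTBilin v t = M.muT v t := rfl

theorem gamBilin_apply (s : M.S₀) (t : M.S₁) : M.gamBilin s t = M.gam s t := rfl

section

variable {M}
variable {E : Type*} [NormedAddCommGroup E] [NormedSpace ℝ E] {x : E}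

theorem contDiffAt_mu {f : E → V} {g : E → M.S₀} (hf : ContDiffAt ℝ ∞ f x)
    (hg : ContDiffAt ℝ ∞ g x) : ContDiffAt ℝ ∞ (fun y => M.mu (f y) (g y)) x :=
  contDiffAt_bilin M.mu hf hg

theorem contDiffAt_muT {f : E → V} {g : E → M.S₁} (hf : ContDiffAt ℝ ∞ f x)
    (hg : ContDiffAt ℝ ∞ g x) : ContDiffAt ℝ ∞ (fun y => M.muT (f y) (g y)) x := by
  simpa only [muTBilin_apply] using contDiffAt_bilin M.muTBilin hf hg

theorem contDiffAt_gam {f : E → M.S₀} {g : E → M.S₁} (hf : ContDiffAt ℝ ∞ f x)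
    (hg : ContDiffAt ℝ ∞ g x) : ContDiffAt ℝ ∞ (fun y => M.gam (f y) (g y)) x := by
  simpa only [gamBilin_apply] using contDiffAt_bilin M.gamBilin hf hg

end

theorem contDiff_adj : ContDiff ℝ ∞ M.adj := by
  rw [contDiff_iff_contDiffAt]
  intro X
  have h1 : ContDiffAt ℝ ∞ (fun X : M.Herm => X.1) X := by fun_prop
  have h2 : ContDiffAt ℝ ∞ (fun X : M.Herm => X.2.1) X := by fun_prop
  have h3 : ContDiffAt ℝ ∞ (fun X : M.Herm => X.2.2.1) X := by fun_prop
  have h4 : ContDiffAt ℝ ∞ (fun X : M.Herm => X.2.2.2.1) X := by fun_prop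
  have h5 : ContDiffAt ℝ ∞ (fun X : M.Herm => X.2.2.2.2.1) X := by fun_prop
  have h6 : ContDiffAt ℝ ∞ (fun X : M.Herm => X.2.2.2.2.2) X := by fun_prop
  exact ((h2.mul h3).sub (h4.norm_sq ℝ)).prodMk <| ((h1.mul h3).sub (h6.norm_sq ℝ)).prodMk <|
    ((h1.mul h2).sub (h5.norm_sq ℝ)).prodMk <| ((contDiffAt_gam h5 h6).sub (h1.smul h4)).prodMk <|
    ((contDiffAt_muT h4 h6).sub (h3.smul h5)).prodMk ((contDiffAt_mu h4 h5).sub (h2.smul h6))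

theorem contDiffAt_dualAdj {Y : M.Herm} (hY : Y.1 ≠ 0) : ContDiffAt ℝ ∞ M.dualAdj Y := by
  have h1 : ContDiffAt ℝ ∞ (fun X : M.Herm => X.1) Y := by fun_prop
  have h2 : ContDiffAt ℝ ∞ (fun X : M.Herm => X.2.1) Y := by fun_prop
  have h3 : ContDiffAt ℝ ∞ (fun X : M.Herm => X.2.2.1) Y := by fun_prop
  have h4 : ContDiffAt ℝ ∞ (fun X : M.Herm => X.2.2.2.1) Y := by fun_prop
  have h5 : ContDiffAt ℝ ∞ (fun X : M.Herm => X.2.2.2.2.1) Y := by fun_prop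
  have h6 : ContDiffAt ℝ ∞ (fun X : M.Herm => X.2.2.2.2.2) Y := by fun_prop
  have hg := contDiffAt_gam h5 h6
  have hu := hg.sub (h1.smul h4)
  have hz2 := (h1.mul h3).sub (h6.norm_sq ℝ)
  have hz3 := (h1.mul h2).sub (h5.norm_sq ℝ)
  have hi := (h1.inv hY).neg
  exact (((h2.mul h3).sub (h4.norm_sq ℝ)).sub ((((h5.norm_sq ℝ).mul (h6.norm_sq ℝ)).sub
    (hg.norm_sq ℝ)).div (h1.pow 2) (pow_ne_zero 2 hY))).prodMk <| hz2.prodMk <| hz3.prodMk <|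
    hu.prodMk <| (hi.smul ((contDiffAt_muT hu h6).add (hz2.smul h5))).prodMk <|
    hi.smul ((contDiffAt_mu hu h5).add (hz3.smul h6))

theorem contDiff_dV : ContDiff ℝ ∞ M.dV := by
  rw [contDiff_iff_contDiffAt]
  intro X
  have h1 : ContDiffAt ℝ ∞ (fun X : M.Herm => X.1) X := by fun_prop
  have h2 : ContDiffAt ℝ ∞ (fun X : M.Herm => X.2.1) X := by fun_prop
  have h3 : ContDiffAt ℝ ∞ (fun X : M.Herm => X.2.2.1) X := by fun_prop
  have h4 : ContDiffAt ℝ ∞ (fun X : M.Herm => X.2.2.2.1) X := by fun_prop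
  have h5 : ContDiffAt ℝ ∞ (fun X : M.Herm => X.2.2.2.2.1) X := by fun_prop
  have h6 : ContDiffAt ℝ ∞ (fun X : M.Herm => X.2.2.2.2.2) X := by fun_prop
  exact (((((h1.mul h2).mul h3).sub (h1.mul (h4.norm_sq ℝ))).sub (h2.mul (h6.norm_sq ℝ))).sub
    (h3.mul (h5.norm_sq ℝ))).add (contDiffAt_const.mul ((contDiffAt_mu h4 h5).inner ℝ h6))

theorem contDiffAt_dualNorm {Y : M.Herm} (hY : Y.1 ≠ 0) : ContDiffAt ℝ ∞ M.dualNorm Y := by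
  have h1 : ContDiffAt ℝ ∞ (fun X : M.Herm => X.1) Y := by fun_prop
  have h5 : ContDiffAt ℝ ∞ (fun X : M.Herm => X.2.2.2.2.1) Y := by fun_prop
  have h6 : ContDiffAt ℝ ∞ (fun X : M.Herm => X.2.2.2.2.2) Y := by fun_prop
  exact M.contDiff_dV.contDiffAt.add ((((h5.norm_sq ℝ).mul (h6.norm_sq ℝ)).sub
    ((contDiffAt_gam h5 h6).norm_sq ℝ)).div h1 hY)

/-- Once differentiability is known, directional derivatives determine the differential, so both
gradients can be computed along lines. -/
theorem hasFDerivAt_of_hasDerivAt_line {E F : Type*} [NormedAddCommGroup E] [NormedSpace ℝ E]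
    [NormedAddCommGroup F] [NormedSpace ℝ F] {f : E → F} {x : E} {f' : E →L[ℝ] F}
    (hf : DifferentiableAt ℝ f x)
    (h : ∀ z, HasDerivAt (fun s : ℝ => f (x + s • z)) (f' z) 0) : HasFDerivAt f f' x := by
  have : fderiv ℝ f x = f' := by
    ext z
    exact (hf.hasFDerivAt.hasLineDerivAt z).unique (h z)
  exact this ▸ hf.hasFDerivAt

theorem flat_mk (x₁ x₂ x₃ y₁ y₂ y₃ : ℝ) (v w : V) (s t : M.S₀) (s' t' : M.S₁) :
    M.flat (x₁, x₂, x₃, v, s, s') (y₁, y₂, y₃, w, t, t') =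
      x₁ * y₁ + x₂ * y₂ + x₃ * y₃ + 2 * inner ℝ v w + 2 * inner ℝ s t + 2 * inner ℝ s' t' := by
  simp only [flat_apply, Mat.tr, Mat.mul, toMat]
  ring

theorem flat_comm (X Y : M.Herm) : M.flat X Y = M.flat Y X := by
  obtain ⟨x₁, x₂, x₃, v, s, s'⟩ := X
  obtain ⟨y₁, y₂, y₃, w, t, t'⟩ := Y
  rw [flat_mk, flat_mk, real_inner_comm, real_inner_comm t, real_inner_comm t']
  ring

theorem hasDerivAt_line {E : Type*} [NormedAddCommGroup E] [NormedSpace ℝ E] (x z : E) :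
    HasDerivAt (fun s : ℝ => x + s • z) z 0 := by
  simpa using ((hasDerivAt_id (0 : ℝ)).smul_const z).const_add x

theorem hasFDerivAt_dV (X : M.Herm) : HasFDerivAt M.dV (M.flat (M.adj X)) X := by
  refine hasFDerivAt_of_hasDerivAt_line
    (M.contDiff_dV.contDiffAt.differentiableAt (by simp)) fun Z => ?_
  obtain ⟨x₁, x₂, x₃, v, s, t⟩ := X
  obtain ⟨z₁, z₂, z₃, w, r, q⟩ := Z
  have h1 := hasDerivAt_line x₁ z₁
  have h2 := hasDerivAt_line x₂ z₂
  have h3 := hasDerivAt_line x₃ z₃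
  have h4 := hasDerivAt_line v w
  have h5 := hasDerivAt_line s r
  have h6 := hasDerivAt_line t q
  have hm : HasDerivAt (fun a : ℝ => M.mu (v + a • w) (s + a • r)) (M.mu v r + M.mu w s) 0 := by
    have := (LinearMap.toContinuousBilinearMap M.mu).hasFDerivAt_of_bilinear
      h4.hasFDerivAt h5.hasFDerivAt
    simpa using this.hasDerivAt
  have := ((((h1.mul h2).mul h3).sub (h1.mul h4.norm_sq)).sub (h2.mul h6.norm_sq)).sub
    (h3.mul h5.norm_sq) |>.add ((hm.inner ℝ h6).const_mul 2)
  refine this.congr_deriv ?_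
  simp only [adj, flat_mk, zero_smul, add_zero, inner_sub_left, inner_add_left, inner_smul_left,
    conj_trivial, inner_mu, inner_muT_left, smul_eq_mul, Pi.mul_apply]
  ring

theorem hasFDerivAt_dualNorm {Y : M.Herm} (hY : Y.1 ≠ 0) :
    HasFDerivAt M.dualNorm (M.flat (M.dualAdj Y)) Y := by
  refine hasFDerivAt_of_hasDerivAt_line
    ((M.contDiffAt_dualNorm hY).differentiableAt (by simp)) fun Z => ?_
  have hd := (M.hasFDerivAt_dV Y).hasLineDerivAt Z
  obtain ⟨x₁, x₂, x₃, v, s, t⟩ := Y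
  obtain ⟨z₁, z₂, z₃, w, r, q⟩ := Z
  simp only at hY
  have h1 := hasDerivAt_line x₁ z₁
  have h5 := hasDerivAt_line s r
  have h6 := hasDerivAt_line t q
  have hg : HasDerivAt (fun a : ℝ => M.gam (s + a • r) (t + a • q)) (M.gam s q + M.gam r t) 0 := by
    simp only [← gamBilin_apply]
    have := (LinearMap.toContinuousBilinearMap M.gamBilin).hasFDerivAt_of_bilinear
      h5.hasFDerivAt h6.hasFDerivAt
    simpa using this.hasDerivAt
  have := HasDerivAt.add hd
    (((h5.norm_sq.mul h6.norm_sq).sub hg.norm_sq).div h1 (by simpa using hY))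
  refine this.congr_deriv ?_
  simp only [adj, dualAdj, flat_mk, zero_smul, add_zero, inner_sub_left, inner_add_left,
    inner_smul_left, inner_sub_right, inner_add_right, inner_smul_right,
    conj_trivial, inner_mu, inner_muT_left, smul_eq_mul, zero_mul, add_zero, Pi.mul_apply,
    Pi.sub_apply]
  rw [real_inner_comm (M.gam s q), real_inner_comm (M.gam r t)]
  field_simp
  ring

/-! ### Explicit formulas for the quadratic maps -/

/-- `♭` as a continuous linear equivalence. -/
def flatL : M.Herm ≃L[ℝ] M.HermDual := M.flat.toContinuousLinearEquiv

theorem flatL_symm_apply (ξ : M.HermDual) : M.flatL.symm ξ = M.flat.symm ξ := rfl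

theorem y₁_flat (X : M.Herm) : M.y₁ (M.flat X) = X.1 := by
  obtain ⟨x₁, x₂, x₃, v, s, t⟩ := X
  simp [y₁, flat_mk]

theorem y₁_eq (ξ : M.HermDual) : M.y₁ ξ = (M.flat.symm ξ).1 := by
  rw [← y₁_flat, LinearEquiv.apply_symm_apply]

theorem isOpen_y₁_ne_zero : IsOpen {ξ : M.HermDual | M.y₁ ξ ≠ 0} := by
  have : Continuous M.y₁ := by unfold y₁; fun_prop
  exact isOpen_ne.preimage this

theorem h_eq (k : ℝ) (X : M.Herm) : M.h k X = (k / 3) • M.flat (M.adj X) := by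
  have h1 : HasFDerivAt (M.d k) (k • M.flat (M.adj X)) X := (M.hasFDerivAt_dV X).const_mul k
  rw [h, h1.fderiv, smul_smul]
  congr 1; ring

theorem d'_eq (k : ℝ) (ξ : M.HermDual) : M.d' k ξ = 1 / k * M.dualNorm (M.flat.symm ξ) := rfl

theorem hasFDerivAt_d' (k : ℝ) {ξ : M.HermDual} (hξ : M.y₁ ξ ≠ 0) :
    HasFDerivAt (M.d' k) ((1 / k) • (M.flat (M.dualAdj (M.flat.symm ξ))).comp
      (M.flatL.symm : M.HermDual →L[ℝ] M.Herm)) ξ := by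
  rw [y₁_eq] at hξ
  exact ((M.hasFDerivAt_dualNorm hξ).comp ξ M.flatL.symm.hasFDerivAt).const_mul (1 / k)

theorem eq_of_forall_dual {X Y : M.Herm} (h : ∀ η : M.HermDual, η X = η Y) : X = Y := by
  refine M.flat.injective (ContinuousLinearMap.ext fun Z => ?_)
  rw [flat_comm, M.flat_comm Y]
  exact h _

/-- The bidual identification is removed by testing against `η = ♭ Z`; symmetry of the trace form
then exchanges the two arguments. -/
theorem h'_eq (k : ℝ) {ξ : M.HermDual} (hξ : M.y₁ ξ ≠ 0) :
    M.h' k ξ = (1 / (3 * k)) • M.dualAdj (M.flat.symm ξ) := by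
  refine M.eq_of_forall_dual fun η => ?_
  rw [apply_h', (M.hasFDerivAt_d' k hξ).fderiv]
  obtain ⟨Z, rfl⟩ := M.flat.surjective η
  simp only [map_smul, smul_apply, ContinuousLinearMap.comp_apply,
    ContinuousLinearEquiv.coe_coe, flatL_symm_apply, LinearEquiv.symm_apply_apply, smul_eq_mul]
  rw [flat_comm, one_div, one_div, one_div, mul_inv]
  ring

theorem contDiff_h (k : ℝ) : ContDiff ℝ ∞ (M.h k) := by
  have : M.h k = fun X => (k / 3) • M.flatL (M.adj X) := funext (M.h_eq k)
  rw [this]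
  exact (M.flatL.contDiff.comp M.contDiff_adj).const_smul (k / 3)

theorem contDiffOn_h' (k : ℝ) : ContDiffOn ℝ ∞ (M.h' k) {ξ | M.y₁ ξ ≠ 0} := by
  have : ContDiffOn ℝ ∞ (fun ξ => (1 / (3 * k)) • M.dualAdj (M.flatL.symm ξ))
      {ξ | M.y₁ ξ ≠ 0} := fun ξ hξ =>
    (((M.contDiffAt_dualAdj (by rwa [Set.mem_ofPred_eq, y₁_eq] at hξ)).comp ξ
      M.flatL.symm.contDiff.contDiffAt).const_smul (1 / (3 * k))).contDiffWithinAt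
  exact this.congr fun ξ hξ => M.h'_eq k hξ

theorem contDiffOn_d' (k : ℝ) : ContDiffOn ℝ ∞ (M.d' k) {ξ | M.y₁ ξ ≠ 0} := fun ξ hξ =>
  (contDiffAt_const.mul ((M.contDiffAt_dualNorm (by rwa [Set.mem_ofPred_eq, y₁_eq] at hξ)).comp ξ
    M.flatL.symm.contDiff.contDiffAt)).contDiffWithinAt

/-! ### Homogeneity, Euler's identities and the two compositions -/

theorem adj_smul (c : ℝ) (X : M.Herm) : M.adj (c • X) = c ^ 2 • M.adj X := by
  obtain ⟨x₁, x₂, x₃, v, s, t⟩ := X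
  simp only [adj, Prod.smul_mk, smul_eq_mul, norm_smul, mul_pow, Real.norm_eq_abs, sq_abs,
    gam_smul_left, gam_smul_right, muT_smul_left, muT_smul_right, map_smul, LinearMap.smul_apply,
    Prod.mk.injEq]
  refine ⟨by ring, by ring, by ring, by module, by module, by module⟩

theorem dualAdj_smul {c : ℝ} (hc : c ≠ 0) (X : M.Herm) :
    M.dualAdj (c • X) = c ^ 2 • M.dualAdj X := by
  obtain ⟨x₁, x₂, x₃, v, s, t⟩ := X
  have hu : M.gam (c • s) (c • t) - (c * x₁) • c • v = c ^ 2 • (M.gam s t - x₁ • v) := by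
    rw [gam_smul_left, gam_smul_right]; module
  simp only [dualAdj, Prod.smul_mk, smul_eq_mul, hu]
  simp only [norm_smul, mul_pow, Real.norm_eq_abs, sq_abs,
    gam_smul_left, gam_smul_right, muT_smul_left, muT_smul_right, map_smul, LinearMap.smul_apply,
    Prod.mk.injEq, mul_inv]
  -- At `x₁ = 0` the inverse and the fraction take the default value `0`, and the formula persists.
  rcases eq_or_ne x₁ 0 with rfl | hx
  · simp; ring
  refine ⟨by field_simp, by ring, by ring, trivial, ?_, ?_⟩
  all_goals match_scalars <;> field_simp

/-- Euler's identity for a function homogeneous of degree three. -/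
theorem flat_adj_self (X : M.Herm) : M.flat (M.adj X) X = 3 * M.dV X := by
  obtain ⟨x₁, x₂, x₃, v, s, t⟩ := X
  simp only [adj, dV, flat_mk, inner_sub_left, inner_smul_left, inner_mu, inner_muT_left,
    real_inner_self_eq_norm_sq, conj_trivial]
  ring

theorem flat_dualAdj_self {Y : M.Herm} (hY : Y.1 ≠ 0) :
    M.flat (M.dualAdj Y) Y = 3 * M.dualNorm Y := by
  obtain ⟨x₁, x₂, x₃, v, s, t⟩ := Y
  simp only at hY
  simp only [dualAdj, dualNorm, frakd, dV, flat_mk, inner_sub_left, inner_add_left,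
    inner_sub_right, inner_smul_right, inner_smul_left, inner_mu, inner_muT_left,
    real_inner_self_eq_norm_sq, conj_trivial]
  field_simp
  ring

theorem h_self (k : ℝ) (X : M.Herm) : M.h k X X = M.d k X := by
  rw [h_eq, smul_apply, flat_adj_self, d, smul_eq_mul]; ring

theorem apply_h'_self (k : ℝ) {ξ : M.HermDual} (hξ : M.y₁ ξ ≠ 0) : ξ (M.h' k ξ) = M.d' k ξ := by
  rw [h'_eq M k hξ, map_smul, d'_eq]
  obtain ⟨Y, rfl⟩ := M.flat.surjective ξ
  rw [y₁_flat] at hξ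
  rw [LinearEquiv.symm_apply_apply, flat_comm, flat_dualAdj_self M hξ, smul_eq_mul, one_div,
    one_div, mul_inv]
  ring

theorem h_smul (k c : ℝ) (X : M.Herm) : M.h k (c • X) = c ^ 2 • M.h k X := by
  rw [h_eq, h_eq, adj_smul, map_smul, smul_comm]

theorem y₁_smul (c : ℝ) (ξ : M.HermDual) : M.y₁ (c • ξ) = c * M.y₁ ξ := rfl

theorem h'_smul (k : ℝ) {c : ℝ} (hc : c ≠ 0) {ξ : M.HermDual} (hξ : M.y₁ ξ ≠ 0) :
    M.h' k (c • ξ) = c ^ 2 • M.h' k ξ := by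
  have : M.y₁ (c • ξ) ≠ 0 := by rw [y₁_smul]; exact mul_ne_zero hc hξ
  rw [h'_eq M k this, h'_eq M k hξ, map_smul, dualAdj_smul M hc, smul_comm]

/-- The scalar is `(1 / (3k)) (k / 3)² dV X = k dV X / 27`. -/
theorem h'_h {k : ℝ} (hk : k ≠ 0) (X : M.Herm) (hX : M.y₁ (M.h k X) ≠ 0) :
    M.h' k (M.h k X) = (M.d k X / 27) • X := by
  rw [h'_eq M k hX]
  rw [h_eq, y₁_smul, y₁_flat] at hX
  rw [h_eq, map_smul, LinearEquiv.symm_apply_apply, dualAdj_smul M (left_ne_zero_of_mul hX),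
    dualAdj_adj M X (right_ne_zero_of_mul hX), smul_smul, smul_smul, d]
  congr 1
  field_simp
  ring

theorem h_h' {k : ℝ} (hk : k ≠ 0) (ξ : M.HermDual) (hξ : M.y₁ ξ ≠ 0) :
    M.h k (M.h' k ξ) = (M.d' k ξ / 27) • ξ := by
  rw [h'_eq M k hξ, h_smul, h_eq, d'_eq]
  rw [y₁_eq] at hξ
  rw [adj_dualAdj M _ hξ, map_smul, LinearEquiv.apply_symm_apply, smul_smul, smul_smul]
  congr 1
  field_simp
  ring

theorem h_one (k : ℝ) : M.h k M.one = (k / 3) • M.flat M.one := by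
  rw [h_eq]
  congr 2
  simp [adj, one, gam, muT]

theorem h'_flat_one (k : ℝ) : M.h' k (M.flat M.one) = (1 / (3 * k)) • M.one := by
  rw [h'_eq M k (by rw [y₁_flat]; simp [one]), LinearEquiv.symm_apply_apply]
  congr 1
  simp [dualAdj, one, gam, muT]

/-! ### Diffeomorphisms of the open sets -/

/-- Evaluating `h X` on both sides of `h'_h` and applying Euler's identity twice. The square
explains why both signs of `d` are sent to positive values of `d'`. -/
theorem d'_h {k : ℝ} (hk : k ≠ 0) (X : M.Herm) (hX : M.y₁ (M.h k X) ≠ 0) :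
    M.d' k (M.h k X) = M.d k X ^ 2 / 27 := by
  rw [← apply_h'_self M k hX, h'_h M hk X hX, map_smul, h_self, smul_eq_mul]; ring

theorem d_h' {k : ℝ} (hk : k ≠ 0) (ξ : M.HermDual) (hξ : M.y₁ ξ ≠ 0) :
    M.d k (M.h' k ξ) = M.d' k ξ ^ 2 / 27 := by
  rw [← h_self, h_h' M hk ξ hξ, smul_apply, apply_h'_self M k hξ, smul_eq_mul]; ring

theorem contDiff_d (k : ℝ) : ContDiff ℝ ∞ (M.d k) := contDiff_const.mul M.contDiff_dV

theorem isOpen_Hplus (k : ℝ) : IsOpen (M.Hplus k) :=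
  (isOpen_lt continuous_const (M.contDiff_d k).continuous).inter
    (M.isOpen_y₁_ne_zero.preimage (M.contDiff_h k).continuous)

theorem isOpen_Hplus' (k : ℝ) : IsOpen (M.Hplus' k) := by
  have := (M.contDiffOn_d' k).continuousOn.isOpen_inter_preimage M.isOpen_y₁_ne_zero
    (isOpen_Ioi (a := (0 : ℝ)))
  rwa [Set.inter_comm] at this

/-- As `h` is even, the sign `ε = ±1` selects the preimage: on its domain `√(27 d'(h X)) = ε d X`,
so the factor `d X / 27` in `h'_h` is a smooth function of `h X` and can be divided out. -/
theorem isDiffeoOnto_h {k ε : ℝ} (hk : 0 < k) (hε : ε ^ 2 = 1) :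
    IsDiffeoOnto (M.h k) {X | 0 < ε * M.d k X ∧ M.y₁ (M.h k X) ≠ 0} (M.Hplus' k) := by
  let g : M.HermDual → M.Herm := fun ξ => (27 * (ε / √(27 * M.d' k ξ))) • M.h' k ξ
  have hg : ∀ X ∈ {X | 0 < ε * M.d k X ∧ M.y₁ (M.h k X) ≠ 0}, g (M.h k X) = X := by
    rintro X ⟨hd, hX⟩
    have h1 : √(27 * M.d' k (M.h k X)) = ε * M.d k X := by
      rw [d'_h M hk.ne' X hX, Real.sqrt_eq_iff_mul_self_eq (by positivity) hd.le]
      linear_combination -(M.d k X) ^ 2 * hε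
    have h0 := right_ne_zero_of_mul hd.ne'
    have h2 := left_ne_zero_of_mul hd.ne'
    simp only [g, h1, h'_h M hk.ne' X hX, smul_smul]
    convert one_smul ℝ X using 2
    field_simp
  have hmaps : Set.MapsTo (M.h k) {X | 0 < ε * M.d k X ∧ M.y₁ (M.h k X) ≠ 0} (M.Hplus' k) := by
    rintro X ⟨hd, hX⟩
    have h0 := right_ne_zero_of_mul hd.ne'
    exact ⟨by rw [d'_h M hk.ne' X hX]; positivity, hX⟩
  have hsurj : ∀ ξ ∈ M.Hplus' k, M.h k (g ξ) = ξ := by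
    rintro ξ ⟨hd, hξ⟩
    simp only [g, h_smul, h_h' M hk.ne' ξ hξ, smul_smul, mul_pow, div_pow, hε,
      Real.sq_sqrt (show 0 ≤ 27 * M.d' k ξ by positivity)]
    convert one_smul ℝ ξ using 2
    field_simp
  refine ⟨⟨hmaps, fun X hX Y hY h => ?_, fun ξ hξ => ⟨g ξ, ⟨?_, ?_⟩, hsurj ξ hξ⟩⟩,
    ⟨Set.univ, isOpen_univ, Set.subset_univ _, (M.contDiff_h k).contDiffOn⟩,
    ⟨g, M.Hplus' k, M.isOpen_Hplus' k, subset_rfl, ?_, hg⟩⟩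
  · rw [← hg X hX, h, hg Y hY]
  -- The sign of `d (g ξ)` is read off from Euler's identity `d (g ξ) = h (g ξ) (g ξ) = ξ (g ξ)`.
  · have h1 := M.h_self k (g ξ)
    rw [hsurj ξ hξ] at h1
    simp only [g, map_smul, apply_h'_self M k hξ.2, smul_eq_mul] at h1
    have h3 : 0 < √(27 * M.d' k ξ) := Real.sqrt_pos.2 (by linarith [hξ.1])
    rw [← h1, show ε * (27 * (ε / √(27 * M.d' k ξ)) * M.d' k ξ) =
      ε ^ 2 * (27 * M.d' k ξ / √(27 * M.d' k ξ)) by ring, hε]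
    have := hξ.1
    positivity
  · rw [hsurj ξ hξ]; exact hξ.2
  · have hsub : M.Hplus' k ⊆ {ξ | M.y₁ ξ ≠ 0} := fun ξ hξ => hξ.2
    refine (contDiffOn_const.mul (contDiffOn_const.div ((contDiffOn_const.mul
      ((M.contDiffOn_d' k).mono hsub)).sqrt fun ξ hξ => ?_) fun ξ hξ => ?_)).smul
      ((M.contDiffOn_h' k).mono hsub)
    · exact (mul_pos (by norm_num) hξ.1).ne'
    · exact (Real.sqrt_pos.2 (mul_pos (by norm_num) hξ.1)).ne'

theorem isDiffeoOnto_h' {k ε : ℝ} (hk : 0 < k) (hε : ε ^ 2 = 1) :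
    IsDiffeoOnto (M.h' k) {ξ | 0 < ε * M.d' k ξ ∧ M.y₁ ξ ≠ 0} (M.Hplus k) := by
  let g : M.Herm → M.HermDual := fun X => (27 * (ε / √(27 * M.d k X))) • M.h k X
  have hg : ∀ ξ ∈ {ξ | 0 < ε * M.d' k ξ ∧ M.y₁ ξ ≠ 0}, g (M.h' k ξ) = ξ := by
    rintro ξ ⟨hd, hξ⟩
    have h1 : √(27 * M.d k (M.h' k ξ)) = ε * M.d' k ξ := by
      rw [d_h' M hk.ne' ξ hξ, Real.sqrt_eq_iff_mul_self_eq (by positivity) hd.le]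
      linear_combination -(M.d' k ξ) ^ 2 * hε
    have h0 := right_ne_zero_of_mul hd.ne'
    have h2 := left_ne_zero_of_mul hd.ne'
    simp only [g, h1, h_h' M hk.ne' ξ hξ, smul_smul]
    convert one_smul ℝ ξ using 2
    field_simp
  have hmaps : Set.MapsTo (M.h' k) {ξ | 0 < ε * M.d' k ξ ∧ M.y₁ ξ ≠ 0} (M.Hplus k) := by
    rintro ξ ⟨hd, hξ⟩
    have h0 := right_ne_zero_of_mul hd.ne'
    refine ⟨by rw [d_h' M hk.ne' ξ hξ]; positivity, ?_⟩
    rw [h_h' M hk.ne' ξ hξ, y₁_smul]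
    positivity
  have hε0 : ε ≠ 0 := fun h => by simp [h] at hε
  -- The rational map `h'` is homogeneous only for nonzero scalars and away from `y₁ = 0`, so both
  -- conditions must be secured before pulling the scalar out.
  have hy : ∀ X ∈ M.Hplus k, M.y₁ (g X) ≠ 0 ∧ 27 * (ε / √(27 * M.d k X)) ≠ 0 := by
    rintro X ⟨hd, hX⟩
    have h3 : 0 < √(27 * M.d k X) := Real.sqrt_pos.2 (by linarith)
    have h4 : 27 * (ε / √(27 * M.d k X)) ≠ 0 := by positivity
    exact ⟨by simp only [g, y₁_smul]; exact mul_ne_zero h4 hX, h4⟩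
  have hsurj : ∀ X ∈ M.Hplus k, M.h' k (g X) = X := by
    rintro X hX'
    obtain ⟨hd, hX⟩ := hX'
    simp only [g]
    rw [h'_smul M k (hy X ⟨hd, hX⟩).2 hX]
    simp only [h'_h M hk.ne' X hX, smul_smul, mul_pow, div_pow, hε,
      Real.sq_sqrt (show 0 ≤ 27 * M.d k X by positivity)]
    convert one_smul ℝ X using 2
    field_simp
  refine ⟨⟨hmaps, fun X hX Y hY h => ?_, fun X hX => ⟨g X, ⟨?_, (hy X hX).1⟩, hsurj X hX⟩⟩,
    ⟨_, M.isOpen_y₁_ne_zero, fun ξ hξ => hξ.2, M.contDiffOn_h' k⟩,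
    ⟨g, M.Hplus k, M.isOpen_Hplus k, subset_rfl, ?_, hg⟩⟩
  · rw [← hg X hX, h, hg Y hY]
  · have h1 := M.apply_h'_self k (hy X hX).1
    rw [hsurj X hX] at h1
    simp only [g, smul_apply, h_self, smul_eq_mul] at h1
    have h3 : 0 < √(27 * M.d k X) := Real.sqrt_pos.2 (by linarith [hX.1])
    rw [← h1, show ε * (27 * (ε / √(27 * M.d k X)) * M.d k X) =
      ε ^ 2 * (27 * M.d k X / √(27 * M.d k X)) by ring, hε]
    have := hX.1
    positivity
  · refine (contDiffOn_const.mul (contDiffOn_const.div ((contDiffOn_const.mul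
      (M.contDiff_d k).contDiffOn).sqrt fun ξ hξ => ?_) fun ξ hξ => ?_)).smul
      (M.contDiff_h k).contDiffOn
    · exact (mul_pos (by norm_num) hξ.1).ne'
    · exact (Real.sqrt_pos.2 (mul_pos (by norm_num) hξ.1)).ne'

end MetricCliffordModule

/-! ### The exponential of a continuous linear map -/

section

variable {E F : Type*} [NormedAddCommGroup E] [NormedSpace ℝ E] [CompleteSpace E]
  [NormedAddCommGroup F] [NormedSpace ℝ F]

theorem hasSum_expMap (L : E →L[ℝ] E) (x : E) :
    HasSum (fun n : ℕ => ((n.factorial : ℝ)⁻¹) • (L ^ n) x) (expMap L x) :=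
  (NormedSpace.exp_series_hasSum_exp' (𝕂 := ℝ) L).mapL (ContinuousLinearMap.apply ℝ E x)

theorem expMap_neg_comp (L : E →L[ℝ] E) (x : E) : expMap (-L) (expMap L x) = x := by
  have h : NormedSpace.exp (-L + L) = NormedSpace.exp (-L) * NormedSpace.exp L := by
    let _ : NormedAlgebra ℚ (E →L[ℝ] E) := NormedAlgebra.restrictScalars ℚ ℝ (E →L[ℝ] E)
    exact NormedSpace.exp_add_of_commute (Commute.neg_left (Commute.refl L))
  rw [neg_add_cancel, NormedSpace.exp_zero] at h
  exact (congrArg (fun A : E →L[ℝ] E => A x) h).symm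

/-- The exponential of a continuous linear map, as an equivalence. -/
def expEquiv (L : E →L[ℝ] E) : E ≃L[ℝ] E :=
  ContinuousLinearEquiv.equivOfInverse (expMap L) (expMap (-L)) (expMap_neg_comp L)
    fun x => by simpa using expMap_neg_comp (-L) x

theorem coe_expEquiv (L : E →L[ℝ] E) : (expEquiv L : E →L[ℝ] E) = expMap L := rfl

theorem expEquiv_symm_apply (L : E →L[ℝ] E) (x : E) : (expEquiv L).symm x = expMap (-L) x := rfl

theorem eq_expEquiv {A : E ≃L[ℝ] E} {L : E →L[ℝ] E} (h : (A : E →L[ℝ] E) = expMap L) :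
    A = expEquiv L := by
  ext x
  exact congrArg (fun B : E →L[ℝ] E => B x) h

theorem hasSum_exp_mul (c : ℝ) (y : F) :
    HasSum (fun n : ℕ => ((n.factorial : ℝ)⁻¹) • (c ^ n • y)) (Real.exp c • y) := by
  have h := NormedSpace.exp_series_hasSum_exp' (𝕂 := ℝ) c
  rw [← Real.exp_eq_exp_ℝ] at h
  simpa [smul_smul] using h.smul_const y

theorem expMap_apply_of_eigenvector {L : E →L[ℝ] E} {c : ℝ} {x : E} (h : L x = c • x) :
    expMap L x = Real.exp c • x := by
  have hn (n : ℕ) : (L ^ n) x = c ^ n • x := by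
    induction n with
    | zero => simp
    | succ n ih => rw [pow_succ, mul_apply_eq_comp, h, map_smul, ih, smul_smul,
        pow_succ']
  have := hasSum_expMap L x
  simp only [hn] at this
  exact this.unique (hasSum_exp_mul c x)

theorem map_expMap_of_eigenform {L : E →L[ℝ] E} {c : ℝ} {φ : E →L[ℝ] F}
    (h : ∀ x, φ (L x) = c • φ x) (x : E) : φ (expMap L x) = Real.exp c • φ x := by
  have hn (n : ℕ) (x : E) : φ ((L ^ n) x) = c ^ n • φ x := by
    induction n generalizing x with
    | zero => simp
    | succ n ih => rw [pow_succ, mul_apply_eq_comp, ih, h, smul_smul, pow_succ]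
  have := (hasSum_expMap L x).mapL φ
  simp only [map_smul, hn] at this
  exact this.unique (hasSum_exp_mul c (φ x))

/-- The exponential series, seen through `φ`, stops after the linear term; `L` itself need not
square to zero. This computes the entries cleared by elimination. -/
theorem map_expMap_of_two_step {L : E →L[ℝ] E} {φ : E →L[ℝ] F}
    (h : ∀ x, φ (L (L x)) = 0) (x : E) : φ (expMap L x) = φ x + φ (L x) := by
  have h1 := (hasSum_expMap L x).mapL φ
  have h2 : HasSum (fun n : ℕ => φ (((n.factorial : ℝ)⁻¹) • (L ^ n) x))
      (∑ n ∈ Finset.range 2, φ (((n.factorial : ℝ)⁻¹) • (L ^ n) x)) := by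
    refine hasSum_sum_of_ne_finset_zero fun n hn => ?_
    obtain ⟨m, rfl⟩ : ∃ m, n = m + 2 := ⟨n - 2, by simp at hn; omega⟩
    rw [map_smul, pow_succ', mul_apply_eq_comp, pow_succ', mul_apply_eq_comp, h, smul_zero]
  rw [h1.unique h2]
  simp [Finset.sum_range_succ]

theorem hasDerivAt_expMap (L : E →L[ℝ] E) (x : E) (t : ℝ) :
    HasDerivAt (fun t : ℝ => expMap (t • L) x) (L (expMap (t • L) x)) t := by
  have h := hasDerivAt_exp_smul_const' (𝕂 := ℝ) L t
  exact ((ContinuousLinearMap.apply ℝ E x).hasFDerivAt.comp_hasDerivAt t h)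

/-- A function that is infinitesimally relatively invariant on a set containing a trajectory is
relatively invariant along it. -/
theorem apply_expMap_of_hasFDerivAt {L : E →L[ℝ] E} {c : ℝ} {Φ : E → ℝ} {Φ' : E → E →L[ℝ] ℝ}
    {U : Set E} (hΦ : ∀ x ∈ U, HasFDerivAt Φ (Φ' x) x) (h : ∀ x ∈ U, Φ' x (L x) = c * Φ x)
    {x : E} (hx : ∀ t : ℝ, expMap (t • L) x ∈ U) :
    Φ (expMap L x) = Real.exp c * Φ x := by
  -- Along the trajectory `Φ` solves `f' = c f`; multiplying by the integrating factor gives a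
  -- constant, compared at times `1` and `0`.
  have hd (t : ℝ) : HasDerivAt (fun t : ℝ => Real.exp (-(t * c)) * Φ (expMap (t • L) x)) 0 t := by
    have h1 := (hΦ _ (hx t)).comp_hasDerivAt t (hasDerivAt_expMap L x t)
    rw [h _ (hx t)] at h1
    have h2 : HasDerivAt (fun t : ℝ => Real.exp (-(t * c))) (Real.exp (-(t * c)) * -(1 * c)) t :=
      ((hasDerivAt_id t).mul_const c).neg.exp
    refine (h2.mul h1).congr_deriv ?_
    simp only [Function.comp]
    ring
  have h0 := is_const_of_deriv_eq_zero (fun t => (hd t).differentiableAt)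
    (fun t => (hd t).deriv) 1 0
  simp only [one_mul, one_smul, zero_mul, neg_zero, Real.exp_zero, zero_smul] at h0
  have h1 : expMap (0 : E →L[ℝ] E) x = x := by simp [expMap, NormedSpace.exp_zero]
  rw [h1] at h0
  rw [← h0, ← mul_assoc, ← Real.exp_add, add_neg_cancel, Real.exp_zero, one_mul]

theorem bilin_expMap {L L' : E →L[ℝ] E} {b : E →L[ℝ] E →L[ℝ] ℝ}
    (h : ∀ x y, b x (L y) = b (L' x) y) (x y : E) :
    b x (expMap L y) = b (expMap L' x) y := by
  have hn (n : ℕ) (x y : E) : b x ((L ^ n) y) = b ((L' ^ n) x) y := by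
    induction n generalizing x y with
    | zero => rfl
    | succ n ih => rw [pow_succ, mul_apply_eq_comp, ih, h, pow_succ',
        mul_apply_eq_comp]
  have h1 := (hasSum_expMap L y).mapL (b x)
  have h2 := (hasSum_expMap L' x).mapL (b.flip y)
  simp only [map_smul, hn, ContinuousLinearMap.flip_apply] at h1 h2
  exact h1.unique h2

end

namespace MetricCliffordModule

variable {V S : Type*} [NormedAddCommGroup V] [InnerProductSpace ℝ V] [FiniteDimensional ℝ V]
  [NormedAddCommGroup S] [InnerProductSpace ℝ S] [FiniteDimensional ℝ S]
  (M : MetricCliffordModule V S)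

set_option linter.unusedSectionVars false
set_option maxSynthPendingDepth 3

/-! ### The infinitesimal action -/

theorem T_apply (B : M.Mat) (X : M.Herm) :
    M.T B X = ((B.mul (M.toMat X)).add ((M.toMat X).mul B.conj)).upperPart := rfl

/-- This carries the dual action of upper triangular exponentials over to lower triangular ones on
`Herm`. -/
theorem flat_T (B : M.Mat) (X Y : M.Herm) : M.flat Y (M.T B X) = M.flat (M.T B.conj Y) X := by
  obtain ⟨x₁, x₂, x₃, v, s, t⟩ := X
  obtain ⟨y₁, y₂, y₃, w, r, q⟩ := Y
  simp only [T_apply, Mat.upperPart, Mat.add, Mat.mul, Mat.conj, toMat, flat_mk,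
    inner_add_left, inner_add_right, inner_smul_left, inner_smul_right, inner_mu, inner_mu_right,
    inner_muT_left, inner_muT_right, conj_trivial]
  simp only [real_inner_comm B.x12, real_inner_comm B.x13, real_inner_comm B.x23,
    real_inner_comm B.x21, real_inner_comm B.x31, real_inner_comm B.x32,
    real_inner_comm w (M.gam _ _)]
  ring

theorem mu_zero_left (s : M.S₀) : M.mu 0 s = 0 := by simp

theorem muT_zero_left (t : M.S₁) : M.muT 0 t = 0 := by simp [muT]

theorem muT_zero_right (v : V) : M.muT v 0 = 0 := by simp [muT]

theorem gam_zero_left (t : M.S₁) : M.gam 0 t = 0 := by simp [gam]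

theorem gam_zero_right (s : M.S₀) : M.gam s 0 = 0 := by simp [gam]

/-- Infinitesimal relative invariance of `dV`. The Clifford relation enters through `e1`, `e2`,
`e3`; the rest is bilinear cancellation. -/
theorem flat_adj_T {B : M.Mat} (hB : B.IsUpper) (X : M.Herm) :
    M.flat (M.adj X) (M.T B X) = 2 * B.tr * M.dV X := by
  obtain ⟨x₁, x₂, x₃, v, s, t⟩ := X
  obtain ⟨b₁, b₂, b₃, σ, τ, ρ, _, _, _⟩ := B
  obtain ⟨h1, h2, h3⟩ := hB
  simp only at h1 h2 h3
  subst h1 h2 h3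
  have e1 : inner ℝ (M.muT v t) (M.muT ρ t) = ‖t‖ ^ 2 * inner ℝ v ρ := by
    rw [inner_muT_right, gam_muT, inner_smul_left]; rfl
  have e2 : inner ℝ (M.mu v s) (M.mu v σ) = ‖v‖ ^ 2 * inner ℝ s σ := by
    rw [← inner_muT, muT_mu_self, inner_smul_left, real_inner_comm]; rfl
  have e3 : inner ℝ (M.muT v t) (M.muT v τ) = ‖v‖ ^ 2 * inner ℝ t τ := by
    rw [inner_muT, mu_muT_self, inner_smul_left, real_inner_comm]; rfl
  simp only [T_apply, adj, dV, Mat.tr, Mat.upperPart, Mat.add, Mat.mul, Mat.conj, toMat, flat_mk,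
    mu_zero_left, gam_zero_left, gam_zero_right, smul_zero, add_zero, zero_add,
    inner_zero_left, inner_zero_right,
    inner_add_right, inner_sub_left, inner_smul_left, inner_smul_right, e1, e2, e3,
    inner_mu, inner_mu_right, inner_muT_left, inner_muT_right, conj_trivial,
    real_inner_self_eq_norm_sq, real_inner_comm s σ, real_inner_comm t τ, real_inner_comm v ρ]
  ring

theorem flat_dualAdj_T {C : M.Mat} (hC : C.IsLower) {Y : M.Herm} (hY : Y.1 ≠ 0) :
    M.flat (M.dualAdj Y) (M.T C Y) = 2 * C.tr * M.dualNorm Y := by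
  obtain ⟨y₁, y₂, y₃, w, s, t⟩ := Y
  obtain ⟨c₁, c₂, c₃, _, _, _, σ, τ, ρ⟩ := C
  obtain ⟨h1, h2, h3⟩ := hC
  simp only at h1 h2 h3 hY
  subst h1 h2 h3
  have e (u : V) : inner ℝ (M.mu u s) (M.mu ρ s) = ‖s‖ ^ 2 * inner ℝ u ρ := by
    rw [inner_mu, gam_mu, inner_smul_left, real_inner_comm]; rfl
  simp only [T_apply, dualAdj, dualNorm, dV, frakd, Mat.tr, Mat.upperPart, Mat.add, Mat.mul,
    Mat.conj, toMat, flat_mk,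
    muT_zero_left, muT_zero_right, gam_zero_left, smul_zero,
    add_zero, zero_add, inner_zero_left, inner_zero_right,
    inner_add_left, inner_add_right, inner_smul_left, inner_smul_right, e,
    inner_mu, inner_mu_right, inner_muT_left, conj_trivial, inner_sub_left, inner_sub_right,
    real_inner_self_eq_norm_sq, real_inner_comm s σ, real_inner_comm t τ, real_inner_comm w ρ]
  simp only [real_inner_comm (M.gam s t) (M.gam σ t), real_inner_comm (M.gam s t) (M.gam s τ),
    real_inner_comm w]
  field_simp
  ring

end MetricCliffordModule

/-- The same smooth extensions serve for the subset, which need not be open; this is how orbits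
inherit the diffeomorphisms. -/
theorem IsDiffeoOnto.restrict {E F : Type*} [NormedAddCommGroup E] [NormedSpace ℝ E]
    [NormedAddCommGroup F] [NormedSpace ℝ F] {f : E → F} {s s' : Set E} {t t' : Set F}
    (h : IsDiffeoOnto f s t) (hs : s' ⊆ s) (ht : f '' s' = t') : IsDiffeoOnto f s' t' := by
  obtain ⟨hb, ⟨U, hU, hsU, hfU⟩, g, W, hW, htW, hgW, hgf⟩ := h
  subst ht
  exact ⟨(hb.injOn.mono hs).bijOn_image, ⟨U, hU, hs.trans hsU, hfU⟩, g, W, hW,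
    (Set.image_mono hs).trans (hb.image_eq.subset.trans htW), hgW, fun x hx => hgf x (hs hx)⟩

namespace MetricCliffordModule

variable {V S : Type*} [NormedAddCommGroup V] [InnerProductSpace ℝ V] [FiniteDimensional ℝ V]
  [NormedAddCommGroup S] [InnerProductSpace ℝ S] [FiniteDimensional ℝ S]
  (M : MetricCliffordModule V S)

set_option linter.unusedSectionVars false
set_option maxSynthPendingDepth 3

/-! ### Relative invariance under the triangular group -/

theorem expEquiv_mem_expGroup {P : M.Mat → Prop} {B : M.Mat} (hB : P B) :
    expEquiv (M.T B) ∈ M.expGroup P :=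
  Subgroup.subset_closure ⟨B, hB, coe_expEquiv _⟩

theorem expGroup_induction {P : M.Mat → Prop} {p : (M.Herm ≃L[ℝ] M.Herm) → Prop}
    (hexp : ∀ B, P B → p (expEquiv (M.T B))) (one : p 1) (mul : ∀ A B, p A → p B → p (A * B))
    (inv : ∀ A, p A → p A⁻¹) {A : M.Herm ≃L[ℝ] M.Herm} (hA : A ∈ M.expGroup P) : p A := by
  refine Subgroup.closure_induction (p := fun A _ => p A) ?_ one
    (fun A B _ _ => mul A B) (fun A _ => inv A) hA
  rintro A ⟨B, hB, h⟩
  rw [eq_expEquiv h]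
  exact hexp B hB

theorem dualAct_apply (A : M.Herm ≃L[ℝ] M.Herm) (ξ : M.HermDual) (X : M.Herm) :
    dualAct A ξ X = ξ (A.symm X) := rfl

theorem dualAct_one (ξ : M.HermDual) : dualAct 1 ξ = ξ := rfl

theorem dualAct_mul (A B : M.Herm ≃L[ℝ] M.Herm) (ξ : M.HermDual) :
    dualAct (A * B) ξ = dualAct A (dualAct B ξ) := rfl

theorem dualAct_smul (A : M.Herm ≃L[ℝ] M.Herm) (c : ℝ) (ξ : M.HermDual) :
    dualAct A (c • ξ) = c • dualAct A ξ := rfl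

theorem dualAct_inv_dualAct (A : M.Herm ≃L[ℝ] M.Herm) (ξ : M.HermDual) :
    dualAct A⁻¹ (dualAct A ξ) = ξ := by
  rw [← dualAct_mul, inv_mul_cancel, dualAct_one]

theorem dualAct_dualAct_inv (A : M.Herm ≃L[ℝ] M.Herm) (ξ : M.HermDual) :
    dualAct A (dualAct A⁻¹ ξ) = ξ := by
  rw [← dualAct_mul, mul_inv_cancel, dualAct_one]

/-- `♭` intertwines `exp L'` and the transpose of `exp L` if `L'` is the transpose of `L`. -/
theorem flat_expMap {L L' : M.Herm →L[ℝ] M.Herm}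
    (h : ∀ X Y, M.flat X (L Y) = M.flat (L' X) Y) (X Y : M.Herm) :
    M.flat X (expMap L Y) = M.flat (expMap L' X) Y :=
  bilin_expMap (b := (M.flatL : M.Herm →L[ℝ] M.HermDual)) h X Y

theorem dualAct_expEquiv_flat (B : M.Mat) (Y : M.Herm) :
    dualAct (expEquiv (M.T B)) (M.flat Y) = M.flat (expMap (-M.T B.conj) Y) := by
  refine ContinuousLinearMap.ext fun X => ?_
  rw [dualAct_apply, expEquiv_symm_apply]
  refine M.flat_expMap (fun X Y => ?_) Y X
  rw [neg_apply, neg_apply, map_neg, map_neg, neg_apply, flat_T]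

/-- `A` multiplies `d` by the positive factor `c` and the dual function by its inverse, and it
multiplies the extreme coordinates by positive factors. -/
structure IsRelInvariant (k : ℝ) (A : M.Herm ≃L[ℝ] M.Herm) (c : ℝ) : Prop where
  pos : 0 < c
  d_apply : ∀ X, M.d k (A X) = c * M.d k X
  y₁_dualAct : ∃ a : ℝ, 0 < a ∧ ∀ ξ, M.y₁ (dualAct A ξ) = a * M.y₁ ξ
  x₃_apply : ∃ a : ℝ, 0 < a ∧ ∀ X, (A X).2.2.1 = a * X.2.2.1
  d'_dualAct : ∀ ξ, M.y₁ ξ ≠ 0 → M.d' k (dualAct A ξ) = c⁻¹ * M.d' k ξ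

theorem isRelInvariant_one (k : ℝ) : M.IsRelInvariant k 1 1 where
  pos := one_pos
  d_apply X := (one_mul _).symm
  y₁_dualAct := ⟨1, one_pos, fun ξ => (one_mul _).symm⟩
  x₃_apply := ⟨1, one_pos, fun X => (one_mul _).symm⟩
  d'_dualAct ξ _ := by rw [inv_one, one_mul]; rfl

variable {M} in
theorem IsRelInvariant.y₁_ne_zero {k c : ℝ} {A : M.Herm ≃L[ℝ] M.Herm}
    (hA : M.IsRelInvariant k A c) {ξ : M.HermDual} (hξ : M.y₁ ξ ≠ 0) :
    M.y₁ (dualAct A ξ) ≠ 0 := by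
  obtain ⟨a, ha, h⟩ := hA.y₁_dualAct
  rw [h]
  exact mul_ne_zero ha.ne' hξ

variable {M} in
theorem IsRelInvariant.mul {k a b : ℝ} {A B : M.Herm ≃L[ℝ] M.Herm} (hA : M.IsRelInvariant k A a)
    (hB : M.IsRelInvariant k B b) : M.IsRelInvariant k (A * B) (a * b) where
  pos := mul_pos hA.pos hB.pos
  d_apply X := by
    rw [mul_assoc, ← hB.d_apply, ← hA.d_apply]; rfl
  y₁_dualAct := by
    obtain ⟨p, hp, h⟩ := hA.y₁_dualAct
    obtain ⟨q, hq, h'⟩ := hB.y₁_dualAct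
    exact ⟨p * q, mul_pos hp hq, fun ξ => by rw [dualAct_mul, h, h', mul_assoc]⟩
  x₃_apply := by
    obtain ⟨p, hp, h⟩ := hA.x₃_apply
    obtain ⟨q, hq, h'⟩ := hB.x₃_apply
    exact ⟨p * q, mul_pos hp hq, fun X => by rw [mul_assoc, ← h', ← h]; rfl⟩
  d'_dualAct ξ hξ := by
    rw [dualAct_mul, hA.d'_dualAct _ (hB.y₁_ne_zero hξ), hB.d'_dualAct _ hξ, mul_inv, mul_assoc]

variable {M} in
theorem IsRelInvariant.inv {k a : ℝ} {A : M.Herm ≃L[ℝ] M.Herm} (hA : M.IsRelInvariant k A a) :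
    M.IsRelInvariant k A⁻¹ a⁻¹ := by
  have hA0 := hA.pos.ne'
  have hAA (X : M.Herm) : A (A⁻¹ X) = X := A.apply_symm_apply X
  obtain ⟨p, hp, h⟩ := hA.y₁_dualAct
  obtain ⟨q, hq, h'⟩ := hA.x₃_apply
  have hy (ξ : M.HermDual) : M.y₁ (dualAct A⁻¹ ξ) = p⁻¹ * M.y₁ ξ := by
    rw [eq_inv_mul_iff_mul_eq₀ hp.ne', ← h, dualAct_dualAct_inv]
  refine ⟨inv_pos.2 hA.pos, fun X => ?_, ⟨p⁻¹, inv_pos.2 hp, hy⟩, ⟨q⁻¹, inv_pos.2 hq, fun X => ?_⟩,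
    fun ξ hξ => ?_⟩
  · rw [eq_inv_mul_iff_mul_eq₀ hA0, ← hA.d_apply, hAA]
  · rw [eq_inv_mul_iff_mul_eq₀ hq.ne', ← h', hAA]
  · have h1 : M.y₁ (dualAct A⁻¹ ξ) ≠ 0 := by
      rw [hy]; exact mul_ne_zero (inv_pos.2 hp).ne' hξ
    have h2 := hA.d'_dualAct _ h1
    rw [dualAct_dualAct_inv] at h2
    rw [h2, inv_inv, mul_inv_cancel_left₀ hA0]

theorem T_apply_fst_of_isLower {C : M.Mat} (hC : C.IsLower) (Y : M.Herm) :
    (M.T C Y).1 = 2 * C.x11 * Y.1 := by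
  obtain ⟨h1, h2, h3⟩ := hC
  simp only [T_apply, Mat.upperPart, Mat.add, Mat.mul, Mat.conj, toMat, h1, h2, inner_zero_left,
    inner_zero_right]
  ring

theorem T_apply_x₃_of_isUpper {B : M.Mat} (hB : B.IsUpper) (X : M.Herm) :
    (M.T B X).2.2.1 = 2 * B.x33 * X.2.2.1 := by
  obtain ⟨h1, h2, h3⟩ := hB
  simp only [T_apply, Mat.upperPart, Mat.add, Mat.mul, Mat.conj, toMat, h2, h3, inner_zero_left,
    inner_zero_right]
  ring

/-- The first coordinate is an eigenform of lower triangular generators, so trajectories never leave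
the domain of `dualNorm`. -/
theorem fst_expMap_neg_T {C : M.Mat} (hC : C.IsLower) (a : ℝ) (Y : M.Herm) :
    (expMap (a • -M.T C) Y).1 = Real.exp (a * -(2 * C.x11)) * Y.1 := by
  refine map_expMap_of_eigenform (φ := ContinuousLinearMap.fst ℝ ℝ _) (fun X => ?_) Y
  change a * -(M.T C X).1 = _
  rw [T_apply_fst_of_isLower M hC]
  simp only [ContinuousLinearMap.coe_fst', smul_eq_mul]
  ring

theorem isRelInvariant_expEquiv (k : ℝ) {B : M.Mat} (hB : B.IsUpper) :
    M.IsRelInvariant k (expEquiv (M.T B)) (Real.exp (2 * B.tr)) := by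
  have hC : B.conj.IsLower := hB
  have hone (ξ : M.HermDual) : M.y₁ (dualAct (expEquiv (M.T B)) ξ) =
      Real.exp (-(2 * B.x11)) * M.y₁ ξ := by
    obtain ⟨Y, rfl⟩ := M.flat.surjective ξ
    have := M.fst_expMap_neg_T hC 1 Y
    rw [one_smul, one_mul] at this
    rw [dualAct_expEquiv_flat, y₁_flat, y₁_flat, this]
    rfl
  refine ⟨Real.exp_pos _, fun X => ?_, ⟨_, Real.exp_pos _, hone⟩,
    ⟨Real.exp (2 * B.x33), Real.exp_pos _, fun X => ?_⟩, fun ξ hξ => ?_⟩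
  · have := apply_expMap_of_hasFDerivAt (L := M.T B) (U := Set.univ) (Φ := M.dV)
      (fun X _ => M.hasFDerivAt_dV X) (fun X _ => M.flat_adj_T hB X) (x := X)
      fun _ => Set.mem_univ _
    rw [d, d, mul_left_comm]
    exact congrArg (k * ·) this
  · exact map_expMap_of_eigenform (L := M.T B)
      (φ := (ContinuousLinearMap.fst ℝ ℝ (V × M.S₀ × M.S₁)) ∘L (ContinuousLinearMap.snd ℝ ℝ _) ∘L
        (ContinuousLinearMap.snd ℝ ℝ _)) (fun X => M.T_apply_x₃_of_isUpper hB X) X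
  · obtain ⟨Y, rfl⟩ := M.flat.surjective ξ
    rw [y₁_flat] at hξ
    rw [dualAct_expEquiv_flat, d'_eq, d'_eq, LinearEquiv.symm_apply_apply,
      LinearEquiv.symm_apply_apply]
    have := apply_expMap_of_hasFDerivAt (L := -M.T B.conj) (U := {Y : M.Herm | Y.1 ≠ 0})
      (c := -(2 * B.tr))
      (Φ := M.dualNorm) (fun X hX => M.hasFDerivAt_dualNorm hX)
      (fun X hX => by
        rw [neg_apply, map_neg, flat_dualAdj_T M hC hX]
        change -(2 * B.tr * _) = _
        ring) (x := Y)
      fun t => by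
        change (expMap (t • -M.T B.conj) Y).1 ≠ 0
        rw [fst_expMap_neg_T M hC]
        exact mul_ne_zero (Real.exp_pos _).ne' hξ
    rw [this, Real.exp_neg]
    ring

theorem exists_isRelInvariant (k : ℝ) {A : M.Herm ≃L[ℝ] M.Herm} (hA : A ∈ M.G) :
    ∃ c, M.IsRelInvariant k A c := by
  refine M.expGroup_induction (p := fun A => ∃ c, M.IsRelInvariant k A c)
    (fun B hB => ⟨_, M.isRelInvariant_expEquiv k hB⟩) ⟨1, M.isRelInvariant_one k⟩ ?_ ?_ hA
  · rintro A B ⟨a, ha⟩ ⟨b, hb⟩; exact ⟨_, ha.mul hb⟩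
  · rintro A ⟨a, ha⟩; exact ⟨_, ha.inv⟩

theorem isRelInvariant_of_mem_G₀ (k : ℝ) {A : M.Herm ≃L[ℝ] M.Herm} (hA : A ∈ M.G₀) :
    M.IsRelInvariant k A 1 := by
  refine M.expGroup_induction (p := fun A => M.IsRelInvariant k A 1)
    (fun B hB => ?_) (M.isRelInvariant_one k) (fun A B ha hb => ?_) (fun A ha => ?_) hA
  · simpa [hB.2] using M.isRelInvariant_expEquiv k hB.1
  · simpa using ha.mul hb
  · simpa using ha.inv

/-! ### Equivariance up to a character -/

section

variable {M}

theorem IsRelInvariant.h_apply {k c : ℝ} {A : M.Herm ≃L[ℝ] M.Herm} (hA : M.IsRelInvariant k A c)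
    (X : M.Herm) : M.h k (A X) = c • dualAct A (M.h k X) := by
  have hd (X : M.Herm) : HasFDerivAt (M.d k) (fderiv ℝ (M.d k) X) X :=
    ((M.contDiff_d k).contDiffAt.differentiableAt (by simp)).hasFDerivAt
  have h1 := (hd (A X)).comp X A.hasFDerivAt
  have h2 : M.d k ∘ A = fun X => c * M.d k X := funext hA.d_apply
  rw [h2] at h1
  have h3 := h1.unique ((hd X).const_mul c)
  refine ContinuousLinearMap.ext fun Z => ?_
  have h4 := congrArg (fun L : M.HermDual => L (A.symm Z)) h3
  simp only [ContinuousLinearMap.comp_apply, ContinuousLinearEquiv.coe_coe,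
    ContinuousLinearEquiv.apply_symm_apply, smul_apply, smul_eq_mul] at h4
  simp only [h, smul_apply, dualAct_apply, smul_eq_mul, h4]
  ring

theorem IsRelInvariant.h'_dualAct {k c : ℝ} {A : M.Herm ≃L[ℝ] M.Herm}
    (hA : M.IsRelInvariant k A c) {ξ : M.HermDual} (hξ : M.y₁ ξ ≠ 0) :
    M.h' k (dualAct A ξ) = c⁻¹ • A (M.h' k ξ) := by
  let D : M.HermDual →L[ℝ] M.HermDual :=
    (ContinuousLinearMap.compL ℝ M.Herm M.Herm ℝ).flip (A.symm : M.Herm →L[ℝ] M.Herm)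
  have hD (η : M.HermDual) : D η = dualAct A η := rfl
  have hd {ξ : M.HermDual} (hξ : M.y₁ ξ ≠ 0) :
      HasFDerivAt (M.d' k) (fderiv ℝ (M.d' k) ξ) ξ :=
    (M.hasFDerivAt_d' k hξ).differentiableAt.hasFDerivAt
  have h1 : HasFDerivAt (M.d' k ∘ D) ((fderiv ℝ (M.d' k) (dualAct A ξ)).comp D) ξ :=
    HasFDerivAt.comp ξ (hd (hA.y₁_ne_zero hξ)) D.hasFDerivAt
  -- Invariance is known only where `y₁ ≠ 0`, but this set is open, which suffices for
  -- differentiating at `ξ`.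
  have h2 : (M.d' k ∘ D) =ᶠ[nhds ξ] fun ξ => c⁻¹ * M.d' k ξ := by
    filter_upwards [M.isOpen_y₁_ne_zero.mem_nhds hξ] with η hη
    exact hA.d'_dualAct η hη
  have h3 := (h1.congr_of_eventuallyEq h2.symm).unique ((hd hξ).const_mul c⁻¹)
  refine A.symm.injective (M.eq_of_forall_dual fun η => ?_)
  rw [← dualAct_apply, apply_h']
  have h4 := congrArg (fun L : M.HermDual →L[ℝ] ℝ => L η) h3
  simp only [ContinuousLinearMap.comp_apply, smul_apply, smul_eq_mul, hD] at h4
  rw [h4, map_smul, ContinuousLinearEquiv.symm_apply_apply, map_smul, apply_h', smul_eq_mul]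
  ring

end

/-! ### Orbits -/

/-- For the scalar matrix `b • I` the generator `X ↦ BX + XB*` is multiplication by `2b`, hence `b =
log c / 2`. Consequently positive factors do not change orbits. -/
theorem exists_smul_mem_G {c : ℝ} (hc : 0 < c) : ∃ A ∈ M.G, ∀ X : M.Herm, A X = c • X := by
  let B : M.Mat := ⟨Real.log c / 2, Real.log c / 2, Real.log c / 2, 0, 0, 0, 0, 0, 0⟩
  refine ⟨expEquiv (M.T B), M.expEquiv_mem_expGroup ⟨rfl, rfl, rfl⟩, fun X => ?_⟩
  have hX : M.T B X = Real.log c • X := by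
    obtain ⟨x₁, x₂, x₃, v, s, t⟩ := X
    simp only [T_apply, Mat.upperPart, Mat.add, Mat.mul, Mat.conj, toMat, B, LinearMap.zero_apply,
      muT_zero_left, muT_zero_right, gam_zero_left, gam_zero_right, smul_zero, map_zero,
      inner_zero_left, inner_zero_right, Prod.smul_mk, Prod.mk.injEq, smul_eq_mul]
    refine ⟨by ring, by ring, by ring, by module, by module, by module⟩
  have := expMap_apply_of_eigenvector hX
  rwa [Real.exp_log hc] at this

theorem dualAct_of_smul {A : M.Herm ≃L[ℝ] M.Herm} {c : ℝ} (hc : c ≠ 0)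
    (hA : ∀ X : M.Herm, A X = c • X) (ξ : M.HermDual) : dualAct A ξ = c⁻¹ • ξ := by
  refine ContinuousLinearMap.ext fun X => ?_
  have : A.symm X = c⁻¹ • X := by
    rw [ContinuousLinearEquiv.symm_apply_eq, hA, smul_inv_smul₀ hc]
  rw [dualAct_apply, this, map_smul, smul_apply]

theorem smul_mem_orbit {c : ℝ} (hc : 0 < c) {X Y : M.Herm} (hY : Y ∈ M.orbit X) :
    c • Y ∈ M.orbit X := by
  obtain ⟨A, hA, rfl⟩ := hY
  obtain ⟨B, hB, h⟩ := M.exists_smul_mem_G hc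
  exact ⟨B * A, mul_mem hB hA, (h _).symm⟩

theorem smul_mem_dualOrbit {c : ℝ} (hc : 0 < c) {ξ η : M.HermDual} (hη : η ∈ M.dualOrbit ξ) :
    c • η ∈ M.dualOrbit ξ := by
  obtain ⟨A, hA, rfl⟩ := hη
  obtain ⟨B, hB, h⟩ := M.exists_smul_mem_G (inv_pos.2 hc)
  exact ⟨B * A, mul_mem hB hA, by
    rw [dualAct_mul, dualAct_of_smul M (inv_pos.2 hc).ne' h, inv_inv]⟩

theorem orbit_smul {c : ℝ} (hc : 0 < c) (X : M.Herm) : M.orbit (c • X) = M.orbit X := by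
  ext Y
  constructor
  · rintro ⟨A, hA, rfl⟩
    rw [map_smul]
    exact M.smul_mem_orbit hc ⟨A, hA, rfl⟩
  · rintro ⟨A, hA, rfl⟩
    have := M.smul_mem_orbit (inv_pos.2 hc) (X := c • X) ⟨A, hA, rfl⟩
    rwa [map_smul, inv_smul_smul₀ hc.ne'] at this

theorem dualOrbit_smul {c : ℝ} (hc : 0 < c) (ξ : M.HermDual) :
    M.dualOrbit (c • ξ) = M.dualOrbit ξ := by
  ext Y
  constructor
  · rintro ⟨A, hA, rfl⟩
    rw [dualAct_smul]
    exact M.smul_mem_dualOrbit hc ⟨A, hA, rfl⟩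
  · rintro ⟨A, hA, rfl⟩
    have := M.smul_mem_dualOrbit (inv_pos.2 hc) (ξ := c • ξ) ⟨A, hA, rfl⟩
    rwa [dualAct_smul, inv_smul_smul₀ hc.ne'] at this

theorem image_h_orbit (k : ℝ) (X : M.Herm) : M.h k '' M.orbit X = M.dualOrbit (M.h k X) := by
  apply subset_antisymm
  · rintro _ ⟨_, ⟨A, hA, rfl⟩, rfl⟩
    obtain ⟨c, hc⟩ := M.exists_isRelInvariant k hA
    rw [hc.h_apply]
    exact M.smul_mem_dualOrbit hc.pos ⟨A, hA, rfl⟩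
  · rintro _ ⟨A, hA, rfl⟩
    obtain ⟨c, hc⟩ := M.exists_isRelInvariant k hA
    have h0 := hc.pos
    -- Since `h` is quadratic, rescaling by `(√c)⁻¹` cancels the factor `c` of `h (A X)`.
    refine ⟨(√c)⁻¹ • A X, M.smul_mem_orbit (by positivity) ⟨A, hA, rfl⟩, ?_⟩
    rw [h_smul, hc.h_apply, smul_smul, inv_pow, Real.sq_sqrt h0.le, inv_mul_cancel₀ h0.ne',
      one_smul]

theorem image_h'_dualOrbit (k : ℝ) {ξ : M.HermDual} (hξ : M.y₁ ξ ≠ 0) :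
    M.h' k '' M.dualOrbit ξ = M.orbit (M.h' k ξ) := by
  apply subset_antisymm
  · rintro _ ⟨_, ⟨A, hA, rfl⟩, rfl⟩
    obtain ⟨c, hc⟩ := M.exists_isRelInvariant k hA
    rw [hc.h'_dualAct hξ]
    exact M.smul_mem_orbit (inv_pos.2 hc.pos) ⟨A, hA, rfl⟩
  · rintro _ ⟨A, hA, rfl⟩
    obtain ⟨c, hc⟩ := M.exists_isRelInvariant k hA
    have h0 := hc.pos
    refine ⟨√c • dualAct A ξ, M.smul_mem_dualOrbit (by positivity) ⟨A, hA, rfl⟩, ?_⟩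
    rw [h'_smul M k (by positivity) (hc.y₁_ne_zero hξ), hc.h'_dualAct hξ, smul_smul,
      Real.sq_sqrt h0.le, mul_inv_cancel₀ h0.ne', one_smul]

theorem y₁_h_ne_zero_of_mem_orbit {k : ℝ} {X Y : M.Herm} (hX : M.y₁ (M.h k X) ≠ 0)
    (hY : Y ∈ M.orbit X) : M.y₁ (M.h k Y) ≠ 0 := by
  obtain ⟨A, hA, rfl⟩ := hY
  obtain ⟨c, hc⟩ := M.exists_isRelInvariant k hA
  rw [hc.h_apply, y₁_smul]
  exact mul_ne_zero hc.pos.ne' (hc.y₁_ne_zero hX)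

theorem orbit_subset_Hplus {k : ℝ} {X : M.Herm} (hX : X ∈ M.Hplus k) :
    M.orbit X ⊆ M.Hplus k := by
  rintro Y hY
  refine ⟨?_, M.y₁_h_ne_zero_of_mem_orbit hX.2 hY⟩
  obtain ⟨A, hA, rfl⟩ := hY
  obtain ⟨c, hc⟩ := M.exists_isRelInvariant k hA
  rw [hc.d_apply]
  exact mul_pos hc.pos hX.1

theorem orbit_subset_Hminus {k : ℝ} {X : M.Herm} (hX : X ∈ M.Hminus k) :
    M.orbit X ⊆ M.Hminus k := by
  rintro Y hY
  refine ⟨?_, M.y₁_h_ne_zero_of_mem_orbit hX.2 hY⟩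
  obtain ⟨A, hA, rfl⟩ := hY
  obtain ⟨c, hc⟩ := M.exists_isRelInvariant k hA
  rw [hc.d_apply]
  exact mul_neg_of_pos_of_neg hc.pos hX.1

theorem dualOrbit_subset_Hplus' {k : ℝ} {ξ : M.HermDual} (hξ : ξ ∈ M.Hplus' k) :
    M.dualOrbit ξ ⊆ M.Hplus' k := by
  rintro _ ⟨A, hA, rfl⟩
  obtain ⟨c, hc⟩ := M.exists_isRelInvariant k hA
  refine ⟨?_, hc.y₁_ne_zero hξ.2⟩
  rw [hc.d'_dualAct ξ hξ.2]
  exact mul_pos (inv_pos.2 hc.pos) hξ.1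

theorem dualOrbit_subset_Hminus' {k : ℝ} {ξ : M.HermDual} (hξ : ξ ∈ M.Hminus' k) :
    M.dualOrbit ξ ⊆ M.Hminus' k := by
  rintro _ ⟨A, hA, rfl⟩
  obtain ⟨c, hc⟩ := M.exists_isRelInvariant k hA
  refine ⟨?_, hc.y₁_ne_zero hξ.2⟩
  rw [hc.d'_dualAct ξ hξ.2]
  exact mul_neg_of_pos_of_neg (inv_pos.2 hc.pos) hξ.1

/-! ### Diffeomorphisms of the signed sets and of orbits -/

theorem isDiffeoOnto_h_Hplus {k : ℝ} (hk : 0 < k) :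
    IsDiffeoOnto (M.h k) (M.Hplus k) (M.Hplus' k) := by
  simpa [Hplus] using M.isDiffeoOnto_h hk (ε := 1) (by norm_num)

theorem isDiffeoOnto_h_Hminus {k : ℝ} (hk : 0 < k) :
    IsDiffeoOnto (M.h k) (M.Hminus k) (M.Hplus' k) := by
  simpa [Hminus] using M.isDiffeoOnto_h hk (ε := -1) (by norm_num)

theorem isDiffeoOnto_h'_Hplus' {k : ℝ} (hk : 0 < k) :
    IsDiffeoOnto (M.h' k) (M.Hplus' k) (M.Hplus k) := by
  simpa [Hplus'] using M.isDiffeoOnto_h' hk (ε := 1) (by norm_num)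

theorem isDiffeoOnto_h'_Hminus' {k : ℝ} (hk : 0 < k) :
    IsDiffeoOnto (M.h' k) (M.Hminus' k) (M.Hplus k) := by
  simpa [Hminus'] using M.isDiffeoOnto_h' hk (ε := -1) (by norm_num)

theorem isDiffeoOnto_h_orbit {k : ℝ} (hk : 0 < k) {X : M.Herm}
    (hX : X ∈ M.Hplus k ∪ M.Hminus k) :
    IsDiffeoOnto (M.h k) (M.orbit X) (M.dualOrbit (M.h k X)) := by
  rcases hX with hX | hX
  · exact (M.isDiffeoOnto_h_Hplus hk).restrict (M.orbit_subset_Hplus hX) (M.image_h_orbit k X)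
  · exact (M.isDiffeoOnto_h_Hminus hk).restrict (M.orbit_subset_Hminus hX) (M.image_h_orbit k X)

theorem isDiffeoOnto_h'_dualOrbit {k : ℝ} (hk : 0 < k) {ξ : M.HermDual}
    (hξ : ξ ∈ M.Hplus' k ∪ M.Hminus' k) :
    IsDiffeoOnto (M.h' k) (M.dualOrbit ξ) (M.orbit (M.h' k ξ)) := by
  rcases hξ with hξ | hξ
  · exact (M.isDiffeoOnto_h'_Hplus' hk).restrict (M.dualOrbit_subset_Hplus' hξ)
      (M.image_h'_dualOrbit k hξ.2)
  · exact (M.isDiffeoOnto_h'_Hminus' hk).restrict (M.dualOrbit_subset_Hminus' hξ)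
      (M.image_h'_dualOrbit k hξ.2)

/-! ### The cones -/

theorem dV_one : M.dV M.one = 1 := by simp [dV, one]

theorem y₁_h (k : ℝ) (X : M.Herm) : M.y₁ (M.h k X) = k / 3 * (M.adj X).1 := by
  rw [h_eq, y₁_smul, y₁_flat]

theorem one_mem_Hplus {k : ℝ} (hk : 0 < k) : M.one ∈ M.Hplus k := by
  refine ⟨by rw [d, dV_one, mul_one]; exact hk, ?_⟩
  rw [h_one, y₁_smul, y₁_flat]
  simp [one, hk.ne']

theorem flat_one_mem_Hplus' {k : ℝ} (hk : 0 < k) : M.flat M.one ∈ M.Hplus' k := by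
  constructor
  · rw [d'_eq, LinearEquiv.symm_apply_apply, dualNorm, dV_one]
    simp [frakd, one, gam, hk]
  · rw [y₁_flat]; simp [one]

/-- The minors of an element of the cone are positive. -/
theorem minors_pos_of_mem_cone {X : M.Herm} (hX : X ∈ M.cone) :
    0 < X.2.2.1 ∧ 0 < (M.adj X).1 ∧ 0 < M.dV X := by
  obtain ⟨A, hA, rfl⟩ := hX
  obtain ⟨c, hc⟩ := M.exists_isRelInvariant 1 hA
  obtain ⟨a, ha, h3⟩ := hc.x₃_apply
  obtain ⟨b, hb, h1⟩ := hc.y₁_dualAct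
  refine ⟨?_, ?_, ?_⟩
  · rw [h3]; simpa [one] using ha
  · have h2 := M.y₁_h 1 (A M.one)
    rw [hc.h_apply, y₁_smul, h1, h_one, y₁_smul, y₁_flat] at h2
    have h4 := mul_pos hc.pos hb
    simp only [one] at h2 ⊢
    linarith
  · have h2 := hc.d_apply M.one
    rw [d, d, one_mul, one_mul, dV_one, mul_one] at h2
    rw [h2]; exact hc.pos

/-- The closed conditions on the diagonal and the `2 × 2` minors of a positive matrix. -/
def IsPosMinors (X : M.Herm) : Prop :=
  0 ≤ X.1 ∧ 0 ≤ X.2.1 ∧ 0 ≤ X.2.2.1 ∧ 0 ≤ (M.adj X).1 ∧ 0 ≤ (M.adj X).2.1 ∧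
    0 ≤ (M.adj X).2.2.1

/-- Positivity of `x₃`, of the first minor and of `dV` comes from relative invariance. The other two
minors follow from `i1` and `i2`: each, times the first minor, is a diagonal entry times `dV` plus a
squared norm. -/
theorem isPosMinors_of_mem_cone {X : M.Herm} (hX : X ∈ M.cone) : M.IsPosMinors X := by
  obtain ⟨h3, h1, hd⟩ := M.minors_pos_of_mem_cone hX
  obtain ⟨x₁, x₂, x₃, v, s, t⟩ := X
  simp only [adj] at h3 h1
  simp only [IsPosMinors, adj]
  have h2 : 0 < x₂ := by
    have : 0 < x₂ * x₃ := by nlinarith [sq_nonneg ‖v‖]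
    exact pos_of_mul_pos_left this h3.le
  have e1 := M.norm_sq_muT_add v s t (-x₃)
  have e2 := M.norm_sq_mu_add v s t (-x₂)
  have i1 : (x₂ * x₃ - ‖v‖ ^ 2) * (x₁ * x₃ - ‖t‖ ^ 2) =
      x₃ * M.dV (x₁, x₂, x₃, v, s, t) + ‖M.muT v t + (-x₃) • s‖ ^ 2 := by
    rw [e1]; simp only [dV, inner_mu]; ring
  have i2 : (x₂ * x₃ - ‖v‖ ^ 2) * (x₁ * x₂ - ‖s‖ ^ 2) =
      x₂ * M.dV (x₁, x₂, x₃, v, s, t) + ‖M.mu v s + (-x₂) • t‖ ^ 2 := by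
    rw [e2]; simp only [dV, inner_mu]; ring
  have m2 : 0 < x₁ * x₃ - ‖t‖ ^ 2 := by
    refine pos_of_mul_pos_right (a := x₂ * x₃ - ‖v‖ ^ 2) ?_ h1.le
    rw [i1]; positivity
  have m3 : 0 < x₁ * x₂ - ‖s‖ ^ 2 := by
    refine pos_of_mul_pos_right (a := x₂ * x₃ - ‖v‖ ^ 2) ?_ h1.le
    rw [i2]; positivity
  have h1' : 0 < x₁ := by
    have : 0 < x₁ * x₃ := by nlinarith [sq_nonneg ‖t‖]
    exact pos_of_mul_pos_left this h3.le
  exact ⟨h1'.le, h2.le, h3.le, h1.le, m2.le, m3.le⟩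

theorem isClosed_isPosMinors : IsClosed {X | M.IsPosMinors X} := by
  have h := M.contDiff_adj.continuous
  have h1 : Continuous fun X => (M.adj X).1 := by fun_prop
  have h2 : Continuous fun X => (M.adj X).2.1 := by fun_prop
  have h3 : Continuous fun X => (M.adj X).2.2.1 := by fun_prop
  refine IsClosed.and (isClosed_le continuous_const (by fun_prop)) <|
    IsClosed.and (isClosed_le continuous_const (by fun_prop)) <|
    IsClosed.and (isClosed_le continuous_const (by fun_prop)) <|
    IsClosed.and (isClosed_le continuous_const h1) <|
    IsClosed.and (isClosed_le continuous_const h2) (isClosed_le continuous_const h3)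

theorem isPosMinors_of_mem_closure_cone {X : M.Herm} (hX : X ∈ closure M.cone) :
    M.IsPosMinors X :=
  closure_minimal (fun _ => M.isPosMinors_of_mem_cone) M.isClosed_isPosMinors hX

/-- Pairing with `I` gives the sum of the diagonal entries. If it is not positive the diagonal
vanishes, and the minors reduce to `-‖v‖²`, `-‖t‖²`, `-‖s‖²`, so `X = 0`. -/
theorem flat_one_mem_adjointCone : M.flat M.one ∈ M.adjointCone := by
  intro X hX hX0
  obtain ⟨h1, h2, h3, m1, m2, m3⟩ := M.isPosMinors_of_mem_closure_cone hX
  obtain ⟨x₁, x₂, x₃, v, s, t⟩ := X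
  simp only [adj] at h1 h2 h3 m1 m2 m3
  have e : M.flat M.one (x₁, x₂, x₃, v, s, t) = x₁ + x₂ + x₃ := by
    simp [one, flat_mk]
  rw [e]
  by_contra hle
  have z1 : x₁ = 0 := by linarith
  have z2 : x₂ = 0 := by linarith
  have z3 : x₃ = 0 := by linarith
  subst z1 z2 z3
  have hv : ‖v‖ = 0 := pow_eq_zero_iff two_ne_zero |>.mp (by nlinarith [sq_nonneg ‖v‖])
  have hs : ‖s‖ = 0 := pow_eq_zero_iff two_ne_zero |>.mp (by nlinarith [sq_nonneg ‖s‖])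
  have ht : ‖t‖ = 0 := pow_eq_zero_iff two_ne_zero |>.mp (by nlinarith [sq_nonneg ‖t‖])
  rw [norm_eq_zero] at hv hs ht
  subst hv hs ht
  exact hX0 rfl

/-- The diagonal matrices in the `T`-algebra. -/
def diagMat (a b c : ℝ) : M.Mat := ⟨a, b, c, 0, 0, 0, 0, 0, 0⟩

theorem expMap_T_diagMat (a b c x₁ x₂ x₃ : ℝ) :
    expMap (M.T (M.diagMat a b c)) (x₁, x₂, x₃, 0, 0, 0) =
      (Real.exp (2 * a) * x₁, Real.exp (2 * b) * x₂, Real.exp (2 * c) * x₃, 0, 0, 0) := by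
  have hT (y₁ y₂ y₃ : ℝ) : M.T (M.diagMat a b c) (y₁, y₂, y₃, 0, 0, 0) =
      (2 * a * y₁, 2 * b * y₂, 2 * c * y₃, 0, 0, 0) := by
    simp only [T_apply, Mat.upperPart, Mat.add, Mat.mul, Mat.conj, toMat, diagMat,
      muT_zero_right, gam_zero_right, smul_zero,
      map_zero, inner_zero_right, Prod.mk.injEq, add_zero]
    refine ⟨by ring, by ring, by ring, trivial⟩
  have h1 : expMap (M.T (M.diagMat a b c)) (x₁, 0, 0, 0, 0, 0) =
      Real.exp (2 * a) • (x₁, 0, 0, 0, 0, 0) :=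
    expMap_apply_of_eigenvector (by rw [hT]; simp)
  have h2 : expMap (M.T (M.diagMat a b c)) (0, x₂, 0, 0, 0, 0) =
      Real.exp (2 * b) • (0, x₂, 0, 0, 0, 0) :=
    expMap_apply_of_eigenvector (by rw [hT]; simp)
  have h3 : expMap (M.T (M.diagMat a b c)) (0, 0, x₃, 0, 0, 0) =
      Real.exp (2 * c) • (0, 0, x₃, 0, 0, 0) :=
    expMap_apply_of_eigenvector (by rw [hT]; simp)
  have e : ((x₁, x₂, x₃, 0, 0, 0) : M.Herm) =
      (x₁, 0, 0, 0, 0, 0) + (0, x₂, 0, 0, 0, 0) + (0, 0, x₃, 0, 0, 0) := by simp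
  rw [e, map_add, map_add, h1, h2, h3]
  simp

theorem expMap_T_diagMat_one {a b c : ℝ} (ha : 0 < a) (hb : 0 < b) (hc : 0 < c) :
    (a, b, c, 0, 0, 0) =
      expMap (M.T (M.diagMat (Real.log a / 2) (Real.log b / 2) (Real.log c / 2))) M.one := by
  rw [one, expMap_T_diagMat]
  simp [mul_div_cancel₀, Real.exp_log, ha, hb, hc]

theorem diag_mem_cone {a b c : ℝ} (ha : 0 < a) (hb : 0 < b) (hc : 0 < c) :
    ((a, b, c, 0, 0, 0) : M.Herm) ∈ M.cone :=
  ⟨expEquiv (M.T (M.diagMat _ _ _)), M.expEquiv_mem_expGroup ⟨rfl, rfl, rfl⟩,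
    M.expMap_T_diagMat_one ha hb hc⟩

theorem diag_mem_dualCone {a b c : ℝ} (ha : 0 < a) (hb : 0 < b) (hc : 0 < c) :
    ((a, b, c, 0, 0, 0) : M.Herm) ∈ M.dualCone :=
  ⟨expEquiv (M.T (M.diagMat _ _ _)), M.expEquiv_mem_expGroup ⟨rfl, rfl, rfl⟩,
    M.expMap_T_diagMat_one ha hb hc⟩

theorem diag_mem_closure_cone {a b c : ℝ} (ha : 0 ≤ a) (hb : 0 ≤ b) (hc : 0 ≤ c) :
    ((a, b, c, 0, 0, 0) : M.Herm) ∈ closure M.cone := by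
  let f : ℝ → M.Herm := fun r => (a + r, b + r, c + r, 0, 0, 0)
  have hf : Continuous f := by fun_prop
  have h1 : Filter.Tendsto f (nhdsWithin 0 (Set.Ioi 0)) (nhds (a, b, c, 0, 0, 0)) := by
    have := hf.tendsto 0
    simp only [f, add_zero] at this
    exact this.mono_left nhdsWithin_le_nhds
  refine mem_closure_of_tendsto h1 ?_
  filter_upwards [self_mem_nhdsWithin] with r hr
  have hr : 0 < r := hr
  exact M.diag_mem_cone (by positivity) (by positivity) (by positivity)

/-! ### The adjoint cone as an orbit, by Gaussian elimination -/

theorem apply_mem_cone {A : M.Herm ≃L[ℝ] M.Herm} (hA : A ∈ M.G) {X : M.Herm}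
    (hX : X ∈ M.cone) : A X ∈ M.cone := by
  obtain ⟨B, hB, rfl⟩ := hX
  exact ⟨A * B, mul_mem hA hB, rfl⟩

theorem apply_mem_closure_cone {A : M.Herm ≃L[ℝ] M.Herm} (hA : A ∈ M.G) {X : M.Herm}
    (hX : X ∈ closure M.cone) : A X ∈ closure M.cone :=
  map_mem_closure A.continuous hX fun _ => M.apply_mem_cone hA

theorem dualAct_mem_adjointCone {A : M.Herm ≃L[ℝ] M.Herm} (hA : A ∈ M.G) {ξ : M.HermDual}
    (hξ : ξ ∈ M.adjointCone) : dualAct A ξ ∈ M.adjointCone := fun Y hY hY0 =>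
  hξ _ (M.apply_mem_closure_cone (inv_mem hA) hY) fun h => hY0 (by
    rw [← A.apply_symm_apply Y]
    exact (congrArg A h).trans (map_zero A))

theorem exists_dualAct_of_mem_Gstar {g : M.Herm ≃L[ℝ] M.Herm} (hg : g ∈ M.Gstar) :
    ∃ A ∈ M.G, ∀ Y, M.flat (g Y) = dualAct A (M.flat Y) := by
  refine M.expGroup_induction (P := Mat.IsLower)
    (p := fun g => ∃ A ∈ M.G, ∀ Y, M.flat (g Y) = dualAct A (M.flat Y))
    (fun C hC => ?_) ⟨1, one_mem _, fun Y => rfl⟩ ?_ ?_ hg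
  · refine ⟨(expEquiv (M.T C.conj))⁻¹, inv_mem (M.expEquiv_mem_expGroup hC), fun Y => ?_⟩
    exact ContinuousLinearMap.ext fun X =>
      (M.flat_expMap (L := M.T C.conj) (L' := M.T C) (fun X Y => M.flat_T C.conj Y X) Y X).symm
  · rintro g g' ⟨A, hA, h⟩ ⟨A', hA', h'⟩
    exact ⟨A * A', mul_mem hA hA', fun Y => by rw [dualAct_mul, ← h', ← h]; rfl⟩
  · rintro g ⟨A, hA, h⟩
    refine ⟨A⁻¹, inv_mem hA, fun Y => ?_⟩
    have h1 := h (g⁻¹ Y)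
    rw [show g (g⁻¹ Y) = Y from g.apply_symm_apply Y] at h1
    rw [h1, dualAct_inv_dualAct]

theorem image_dualCone_subset_dualOrbit : M.flat '' M.dualCone ⊆ M.dualOrbit (M.flat M.one) := by
  rintro _ ⟨_, ⟨g, hg, rfl⟩, rfl⟩
  obtain ⟨A, hA, h⟩ := M.exists_dualAct_of_mem_Gstar hg
  exact ⟨A, hA, h _⟩

theorem dualOrbit_subset_adjointCone : M.dualOrbit (M.flat M.one) ⊆ M.adjointCone := by
  rintro _ ⟨A, hA, rfl⟩
  exact M.dualAct_mem_adjointCone hA M.flat_one_mem_adjointCone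

/-- To show that `Y` lies in the dual cone we may first apply `exp T_C`, `C` lower triangular. -/
theorem mem_dualCone_of_expMap {C : M.Mat} (hC : C.IsLower) {Y : M.Herm}
    (hY : M.flat Y ∈ M.adjointCone)
    (h : M.flat (expMap (M.T C) Y) ∈ M.adjointCone → expMap (M.T C) Y ∈ M.dualCone) :
    Y ∈ M.dualCone := by
  have hg : expEquiv (M.T C) ∈ M.Gstar := M.expEquiv_mem_expGroup hC
  obtain ⟨A, hA, hAY⟩ := M.exists_dualAct_of_mem_Gstar hg
  have h1 : M.flat (expMap (M.T C) Y) ∈ M.adjointCone := by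
    have := M.dualAct_mem_adjointCone hA hY
    rwa [← hAY] at this
  obtain ⟨g, hg', e⟩ := h h1
  refine ⟨(expEquiv (M.T C))⁻¹ * g, mul_mem (inv_mem hg) hg', ?_⟩
  have : Y = (expEquiv (M.T C))⁻¹ (expMap (M.T C) Y) := ((expEquiv (M.T C)).symm_apply_apply Y).symm
  rw [this, e]
  rfl

/-- The three diagonal idempotents lie in the closure of the cone, and pairing with them extracts
the diagonal. These entries serve as pivots. -/
theorem diag_pos_of_mem_adjointCone {Y : M.Herm} (hY : M.flat Y ∈ M.adjointCone) :
    0 < Y.1 ∧ 0 < Y.2.1 ∧ 0 < Y.2.2.1 := by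
  obtain ⟨y₁, y₂, y₃, w, s, t⟩ := Y
  have h1 := hY _ (M.diag_mem_closure_cone zero_le_one le_rfl le_rfl) (by simp)
  have h2 := hY _ (M.diag_mem_closure_cone le_rfl zero_le_one le_rfl) (by simp)
  have h3 := hY _ (M.diag_mem_closure_cone le_rfl le_rfl zero_le_one) (by simp)
  simp only [flat_mk, inner_zero_right, mul_zero, mul_one, add_zero, zero_add] at h1 h2 h3
  exact ⟨h1, h2, h3⟩

theorem mem_dualCone_of_spinor_eq_zero {y₁ y₂ y₃ : ℝ} {w : V}
    (hY : M.flat (y₁, y₂, y₃, w, 0, 0) ∈ M.adjointCone) :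
    (y₁, y₂, y₃, w, 0, 0) ∈ M.dualCone := by
  have hy := (M.diag_pos_of_mem_adjointCone hY).2.1
  simp only at hy
  -- Elimination with pivot `y₂`: the linear term of `exp (T C)` subtracts `w`, and no further terms
  -- reach the off-diagonal entries because `T C` annihilates the coordinates `x₂` and `s₀` that
  -- feed them.
  let C : M.Mat := ⟨0, 0, 0, 0, 0, 0, 0, 0, -(y₂⁻¹ • w)⟩
  refine M.mem_dualCone_of_expMap (C := C) ⟨rfl, rfl, rfl⟩ hY fun h => ?_
  have hT (z₁ z₂ z₃ : ℝ) (u : V) (s : M.S₀) (t : M.S₁) : M.T C (z₁, z₂, z₃, u, s, t) =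
      (0, 0, -(2 * y₂⁻¹ * inner ℝ w u), -((z₂ * y₂⁻¹) • w), 0, -(y₂⁻¹ • M.mu w s)) := by
    simp only [T_apply, Mat.upperPart, Mat.add, Mat.mul, Mat.conj, toMat, C,
      map_zero, muT_zero_left, muT_zero_right, gam_zero_left, gam_zero_right,
      smul_zero, zero_smul, zero_mul, mul_zero, map_neg, map_smul, LinearMap.neg_apply,
      LinearMap.smul_apply, inner_neg_left, inner_neg_right, inner_smul_left, inner_smul_right,
      conj_trivial, inner_zero_left, inner_zero_right, Prod.mk.injEq, add_zero, zero_add,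
      real_inner_comm w u]
    refine ⟨trivial, trivial, by ring, by module, trivial⟩
  let p3 : M.Herm →L[ℝ] (V × M.S₀ × M.S₁) := ContinuousLinearMap.snd ℝ ℝ _ ∘L
    ContinuousLinearMap.snd ℝ ℝ _ ∘L ContinuousLinearMap.snd ℝ ℝ _
  have hv := map_expMap_of_two_step (L := M.T C) (φ := p3)
    (fun X => by
      obtain ⟨z₁, z₂, z₃, u, s, t⟩ := X
      simp [hT, p3]) (y₁, y₂, y₃, w, 0, 0)
  have hv' : p3 (expMap (M.T C) (y₁, y₂, y₃, w, 0, 0)) = 0 := by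
    rw [hv, hT]
    simp [p3, mul_inv_cancel₀ hy.ne']
  have hpos := M.diag_pos_of_mem_adjointCone h
  generalize expMap (M.T C) (y₁, y₂, y₃, w, 0, 0) = Z at hv' hpos
  obtain ⟨z₁, z₂, z₃, u, s, t⟩ := Z
  have hz : (u, s, t) = 0 := hv'
  simp only [Prod.mk_eq_zero] at hz
  obtain ⟨rfl, rfl, rfl⟩ := hz
  exact M.diag_mem_dualCone hpos.1 hpos.2.1 hpos.2.2

theorem mem_dualCone_of_mem_adjointCone {Y : M.Herm} (hY : M.flat Y ∈ M.adjointCone) :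
    Y ∈ M.dualCone := by
  obtain ⟨y₁, y₂, y₃, w, r, q⟩ := Y
  have hy := (M.diag_pos_of_mem_adjointCone hY).1
  simp only at hy
  -- Elimination with pivot `y₁` clears both spinor entries at once; their increment depends only on
  -- the first coordinate, which `T C` annihilates.
  let C : M.Mat := ⟨0, 0, 0, 0, 0, 0, -(y₁⁻¹ • r), -(y₁⁻¹ • q), 0⟩
  refine M.mem_dualCone_of_expMap (C := C) ⟨rfl, rfl, rfl⟩ hY fun h => ?_
  let p4 : M.Herm →L[ℝ] (M.S₀ × M.S₁) := ContinuousLinearMap.snd ℝ V _ ∘L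
    ContinuousLinearMap.snd ℝ ℝ _ ∘L
    ContinuousLinearMap.snd ℝ ℝ _ ∘L ContinuousLinearMap.snd ℝ ℝ _
  have hp (X : M.Herm) : p4 X = X.2.2.2.2 := rfl
  have hT (X : M.Herm) : p4 (M.T C X) = -((X.1 * y₁⁻¹) • (r, q)) := by
    obtain ⟨z₁, z₂, z₃, u, s, t⟩ := X
    simp only [hp, T_apply, Mat.upperPart, Mat.add, Mat.mul, Mat.conj, toMat, C,
      LinearMap.zero_apply, muT_zero_left, muT_zero_right, map_zero,
      smul_zero, zero_smul, Prod.smul_mk, Prod.neg_mk, Prod.mk.injEq, add_zero, zero_add]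
    exact ⟨by module, by module⟩
  have hT1 (X : M.Herm) : (M.T C X).1 = 0 := by
    rw [T_apply_fst_of_isLower M ⟨rfl, rfl, rfl⟩]; simp [C]
  have hv := map_expMap_of_two_step (L := M.T C) (φ := p4)
    (fun X => by rw [hT, hT1]; simp) (y₁, y₂, y₃, w, r, q)
  rw [hT, mul_inv_cancel₀ hy.ne', one_smul, hp, hp,
    add_neg_cancel] at hv
  generalize expMap (M.T C) (y₁, y₂, y₃, w, r, q) = Z at hv h
  obtain ⟨z₁, z₂, z₃, u, s, t⟩ := Z
  have hz : (s, t) = 0 := hv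
  simp only [Prod.mk_eq_zero] at hz
  obtain ⟨rfl, rfl⟩ := hz
  exact M.mem_dualCone_of_spinor_eq_zero h

theorem adjointCone_eq_image_dualCone : M.adjointCone = M.flat '' M.dualCone := by
  refine subset_antisymm (fun ξ hξ => ?_)
    (M.image_dualCone_subset_dualOrbit.trans M.dualOrbit_subset_adjointCone)
  obtain ⟨Y, rfl⟩ := M.flat.surjective ξ
  exact ⟨Y, M.mem_dualCone_of_mem_adjointCone hξ, rfl⟩

theorem adjointCone_eq_dualOrbit : M.adjointCone = M.dualOrbit (M.flat M.one) :=
  subset_antisymm (M.adjointCone_eq_image_dualCone.trans_subset M.image_dualCone_subset_dualOrbit)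
    M.dualOrbit_subset_adjointCone

theorem isDiffeoOnto_h_cone {k : ℝ} (hk : 0 < k) :
    IsDiffeoOnto (M.h k) M.cone M.adjointCone := by
  have := M.isDiffeoOnto_h_orbit hk (Or.inl (M.one_mem_Hplus hk))
  rwa [h_one, dualOrbit_smul M (by positivity), ← adjointCone_eq_dualOrbit] at this

theorem isDiffeoOnto_h'_adjointCone {k : ℝ} (hk : 0 < k) :
    IsDiffeoOnto (M.h' k) M.adjointCone M.cone := by
  have := M.isDiffeoOnto_h'_dualOrbit hk (Or.inl (M.flat_one_mem_Hplus' hk))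
  rwa [h'_flat_one, orbit_smul M (by positivity), ← adjointCone_eq_dualOrbit] at this

end MetricCliffordModule

end SpecialVinberg

end

/-! ### Assembly of the five statements -/

theorem mainTheorem2 {V S : Type*}
    [NormedAddCommGroup V] [InnerProductSpace ℝ V] [FiniteDimensional ℝ V]
    [NormedAddCommGroup S] [InnerProductSpace ℝ S] [FiniteDimensional ℝ S]
    (M : SpecialVinberg.MetricCliffordModule V S) (k : ℝ) (hk : 0 < k) :
    -- (i) equivariance under `G₀`; orbits of `G` are mapped into orbits of `G`
    ((∀ A ∈ M.G₀, ∀ X : M.Herm, M.h k (A X) = SpecialVinberg.MetricCliffordModule.dualAct A (M.h k X)) ∧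
      (∀ A ∈ M.G₀, ∀ ξ : M.HermDual, M.y₁ ξ ≠ 0 →
        M.y₁ (SpecialVinberg.MetricCliffordModule.dualAct A ξ) ≠ 0 ∧ M.h' k (SpecialVinberg.MetricCliffordModule.dualAct A ξ) = A (M.h' k ξ)) ∧
      (∀ X : M.Herm, Set.MapsTo (M.h k) (M.orbit X) (M.dualOrbit (M.h k X))) ∧
      (∀ ξ : M.HermDual, M.y₁ ξ ≠ 0 →
        Set.MapsTo (M.h' k) (M.dualOrbit ξ) (M.orbit (M.h' k ξ)))) ∧
    -- (ii) values at the identity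
    (M.h k M.one = (k / 3) • M.flat M.one ∧
      M.h' k (M.flat M.one) = (1 / (3 * k)) • M.one) ∧
    -- (iii) generalized adjoint identities
    ((∀ X : M.Herm, M.y₁ (M.h k X) ≠ 0 → M.h' k (M.h k X) = (M.d k X / 27) • X) ∧
      (∀ ξ : M.HermDual, M.y₁ ξ ≠ 0 → M.h k (M.h' k ξ) = (M.d' k ξ / 27) • ξ)) ∧
    -- (ii) and (iii) for the unnormalised gradient maps `3 h` and `3 h'`
    ((3 : ℝ) • M.h k M.one = k • M.flat M.one ∧
      (3 : ℝ) • M.h' k (M.flat M.one) = (1 / k) • M.one ∧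
      (∀ X : M.Herm, M.y₁ (M.h k X) ≠ 0 →
        (3 : ℝ) • M.h' k ((3 : ℝ) • M.h k X) = M.d k X • X) ∧
      (∀ ξ : M.HermDual, M.y₁ ξ ≠ 0 →
        (3 : ℝ) • M.h k ((3 : ℝ) • M.h' k ξ) = M.d' k ξ • ξ)) ∧
    -- (iv) diffeomorphisms of orbits, the zero sets, and the cones
    ((∀ X ∈ M.Hplus k ∪ M.Hminus k,
        M.orbit X ⊆ M.Hplus k ∪ M.Hminus k ∧ M.dualOrbit (M.h k X) ⊆ M.Hplus' k ∧
        SpecialVinberg.IsDiffeoOnto (M.h k) (M.orbit X) (M.dualOrbit (M.h k X))) ∧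
      (∀ ξ ∈ M.Hplus' k ∪ M.Hminus' k,
        M.dualOrbit ξ ⊆ M.Hplus' k ∪ M.Hminus' k ∧ M.orbit (M.h' k ξ) ⊆ M.Hplus k ∧
        SpecialVinberg.IsDiffeoOnto (M.h' k) (M.dualOrbit ξ) (M.orbit (M.h' k ξ))) ∧
      Set.MapsTo (M.h k) (M.Hzero k) (M.Hzero' k) ∧
      Set.MapsTo (M.h' k) (M.Hzero' k) {X | M.d k X = 0} ∧
      M.cone ⊆ M.Hplus k ∧ M.adjointCone ⊆ M.Hplus' k ∧
      M.adjointCone = M.flat '' M.dualCone ∧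
      SpecialVinberg.IsDiffeoOnto (M.h k) M.cone M.adjointCone ∧
      SpecialVinberg.IsDiffeoOnto (M.h' k) M.adjointCone M.cone) ∧
    -- (v) diffeomorphisms of the open sets
    (SpecialVinberg.IsDiffeoOnto (M.h k) (M.Hplus k) (M.Hplus' k) ∧
      SpecialVinberg.IsDiffeoOnto (M.h k) (M.Hminus k) (M.Hplus' k) ∧
      SpecialVinberg.IsDiffeoOnto (M.h' k) (M.Hplus' k) (M.Hplus k) ∧
      SpecialVinberg.IsDiffeoOnto (M.h' k) (M.Hminus' k) (M.Hplus k)) := by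
  have hplus {X : M.Herm} (hX : X ∈ M.Hplus k ∪ M.Hminus k) : M.h k X ∈ M.Hplus' k :=
    hX.elim (fun hX => (M.isDiffeoOnto_h_Hplus hk).1.mapsTo hX)
      fun hX => (M.isDiffeoOnto_h_Hminus hk).1.mapsTo hX
  have hplus' {ξ : M.HermDual} (hξ : ξ ∈ M.Hplus' k ∪ M.Hminus' k) : M.h' k ξ ∈ M.Hplus k :=
    hξ.elim (fun hξ => (M.isDiffeoOnto_h'_Hplus' hk).1.mapsTo hξ)
      fun hξ => (M.isDiffeoOnto_h'_Hminus' hk).1.mapsTo hξ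
  refine ⟨⟨fun A hA X => ?_, fun A hA ξ hξ => ⟨(M.isRelInvariant_of_mem_G₀ k hA).y₁_ne_zero hξ, ?_⟩,
    fun X => Set.mapsTo_iff_image_subset.2 (M.image_h_orbit k X).subset,
    fun ξ hξ => Set.mapsTo_iff_image_subset.2 (M.image_h'_dualOrbit k hξ).subset⟩,
    ⟨M.h_one k, M.h'_flat_one k⟩, ⟨M.h'_h hk.ne', M.h_h' hk.ne'⟩,
    ⟨?_, ?_, fun X hX => ?_, fun ξ hξ => ?_⟩,
    ⟨fun X hX => ⟨?_, M.dualOrbit_subset_Hplus' (hplus hX), M.isDiffeoOnto_h_orbit hk hX⟩,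
      fun ξ hξ => ⟨?_, M.orbit_subset_Hplus (hplus' hξ), M.isDiffeoOnto_h'_dualOrbit hk hξ⟩,
      fun X hX => ⟨?_, hX.2⟩, fun ξ hξ => ?_, M.orbit_subset_Hplus (M.one_mem_Hplus hk), ?_,
      M.adjointCone_eq_image_dualCone, M.isDiffeoOnto_h_cone hk,
      M.isDiffeoOnto_h'_adjointCone hk⟩,
    M.isDiffeoOnto_h_Hplus hk, M.isDiffeoOnto_h_Hminus hk, M.isDiffeoOnto_h'_Hplus' hk,
    M.isDiffeoOnto_h'_Hminus' hk⟩
  · rw [(M.isRelInvariant_of_mem_G₀ k hA).h_apply, one_smul]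
  · rw [(M.isRelInvariant_of_mem_G₀ k hA).h'_dualAct hξ, inv_one, one_smul]
  · rw [M.h_one, smul_smul, mul_div_cancel₀ k (three_ne_zero' ℝ)]
  · rw [M.h'_flat_one, smul_smul]
    congr 1
    field_simp
  -- The inner factor `3` is squared by homogeneity, and `3 · 3² / 27 = 1`.
  · rw [M.h'_smul k (three_ne_zero' ℝ) hX, M.h'_h hk.ne' X hX, smul_smul, smul_smul]
    congr 1
    ring
  · rw [M.h_smul, M.h_h' hk.ne' ξ hξ, smul_smul, smul_smul]
    congr 1
    ring
  · exact hX.elim (fun hX => (M.orbit_subset_Hplus hX).trans Set.subset_union_left)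
      fun hX => (M.orbit_subset_Hminus hX).trans Set.subset_union_right
  · exact hξ.elim (fun hξ => (M.dualOrbit_subset_Hplus' hξ).trans Set.subset_union_left)
      fun hξ => (M.dualOrbit_subset_Hminus' hξ).trans Set.subset_union_right
  · rw [M.d'_h hk.ne' X hX.2, hX.1]; norm_num
  · change M.d k (M.h' k ξ) = 0
    rw [M.d_h' hk.ne' ξ hξ.2, hξ.1]; norm_num
  · rw [M.adjointCone_eq_dualOrbit]
    exact M.dualOrbit_subset_Hplus' (M.flat_one_mem_Hplus' hk)
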